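/- Let $n=N^2-1$ and let $F_1,\dots,F_n$ be traceless Hermitian $N\times N$ matrices with $\mathrm{Tr}(F_jF_k)=\delta_{jk}$, with structure constants given by $[F_j,F_k]=i\sum_l f_{jkl}F_l$ and $\{F_j,F_k\}=\tfrac2N\delta_{jk}\mathbb 1+\sum_l g_{jkl}F_l$. A driven closed $N$-level system consists of a traceless Hermitian drift Hamiltonian $H=\sum_l\theta_lF_l$, an initial density matrix $\rho_0$ and traceless observables $O_1,\dots,O_p$; its state obeys $\dot\rho=-i[H+\sum_k u_k(t)F_k,\rho]$ and one measures $y_q=\mathrm{Tr}(O_q\rho)$. In terms of the coherence vector $x_j=\mathrm{Tr}(F_j\rho)$ the measurement dynamics has the bilinear (BDS) form $$\dot x=\mathbf Ax+\sum_j u_j(t)\mathbf N_jx,\quad x(0)=b,\quad y=\mathbf Cx,$$ $$\mathbf A_{jk}=-\sum_l\theta_lf_{jkl},\quad(\mathbf N_j)_{kl}=-f_{jkl},\quad b_j=\mathrm{Tr}(F_j\rho_0),\quad \mathbf C_{qk}=\mathrm{Tr}(F_kO_q).$$ Let $\mathbf{CM}^{(bi)}$ be the matrix with columns $\mathbf A_{i_1}\cdots\mathbf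 A_{i_k}b$ and $\mathbf{OM}^{(bi)}$ the matrix with rows $\mathbf C_q\mathbf A_{i_1}\cdots\mathbf A_{i_k}$, where $0\le k\le n-1$, $\mathbf A_{i}\in\{\mathbf A,\mathbf N_1,\dots,\mathbf N_n\}$ and $\mathbf C_q$ is the $q$-th row of $\mathbf C$. For $\alpha\neq0$ let $\mathcal V_\alpha$ be the family of all pulses of amplitude $\alpha$: $u(t)=\alpha e$ for $0\le t<\tau$ and $u(t)=0$ for $t\ge\tau$, with any width $\tau\ge0$ and any unit vector $e\in\mathbb R^n$. Suppose that $\mathbf{CM}^{(bi)}$ and $\mathbf{OM}^{(bi)}$ of a driven closed system have full rank $n$. Fix $\alpha\ne0$ and a sampling period $\Delta>0$. Then: 1. (Identifiability of the BDS form.) If another driven closed system with the same $N$, $p$ and generators (but possibly different Hamiltonian, initial state and observables) produces the same outputs at all times $0,\Delta,2\Delta,\dots$ for every input in $\mathcal V_\alpha$, then its BDS form $(\hat{\mathbf A},\hat{\mathbf N}_j,\hat b,\hat{\mathbf C})$ is similar to that of the given system: $\hat{\mathbf A}=T^{-1}\mathbf AT$, $\hat{\mathbf N}_j=T^{-1}\mathbf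 N_jT$, $\hat b=T^{-1}b$, $\hat{\mathbf C}=\mathbf CT$ for some invertible real $T$. 2. (Reconstruction of the Hamiltonian.) Put $z_{jkl}=f_{jkl}+ig_{jkl}$, $D^{(j,k)}_{lm}=\tfrac14\sum_r(z_{lrk}f_{jmr}+\overline{z_{mrk}}f_{jlr})$, $(\mathbf T_1)_{(j,k),l}=-f_{jkl}$, $(\mathbf T_2)_{(j,k),(l,m)}=-D^{(j,k)}_{lm}$ and $$\mathbf M=\begin{bmatrix}\mathbf T_1&\mathbf T_2\\0&\tfrac iN\mathbf T_1^\top\end{bmatrix}.$$ If $\mathbf M$ is invertible, then every system as in 1 has the same Hamiltonian $H$. Moreover, from the system matrix $\hat{\mathbf A}$ of any such system, $H$ is recovered through $\mathbf M$: the equation $\mathbf Mw=(\mathrm{vec}\,\hat{\mathbf A},0)$ has exactly one solution, it has the form $w=(\theta,0)$ with $\theta\in\mathbb R^n$, and $H=\sum_j\theta_jF_j$. -/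

import Mathlib

open scoped Matrix ComplexOrder

noncomputable section

/-- A bilinear dynamical system
`x' = A x + ∑ j, u_j(t) N_j x`, `x(0) = b`, `y = C x`
with `n` states, `m` control channels and `p` outputs. -/
structure BDS (n m p : ℕ) where
  A : Matrix (Fin n) (Fin n) ℝ
  N : Fin m → Matrix (Fin n) (Fin n) ℝ
  b : Fin n → ℝ
  C : Matrix (Fin p) (Fin n) ℝ

namespace BDS

variable {n m p : ℕ}

/-- The right-hand side `A + ∑ j, v_j N_j` for the control value `v`. -/
def generator (σ : BDS n m p) (v : Fin m → ℝ) : Matrix (Fin n) (Fin n) ℝ :=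
  σ.A + ∑ j, v j • σ.N j

/-- `x` is the state trajectory on `[0, ∞)` for the input `u`: it is continuous and solves the
initial value problem in integrated form (inputs such as pulses may jump). -/
def IsTrajectory (σ : BDS n m p) (u : ℝ → Fin m → ℝ) (x : ℝ → Fin n → ℝ) : Prop :=
  ContinuousOn x (Set.Ici 0) ∧
    ∀ t : ℝ, 0 ≤ t →
      IntervalIntegrable (fun s => σ.generator (u s) *ᵥ x s) MeasureTheory.volume 0 t ∧
        x t = σ.b + ∫ s in (0 : ℝ)..t, σ.generator (u s) *ᵥ x s

/-- `y` is the output on `[0, ∞)` for the input `u`. -/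
def IsOutput (σ : BDS n m p) (u : ℝ → Fin m → ℝ) (y : ℝ → Fin p → ℝ) : Prop :=
  ∃ x, σ.IsTrajectory u x ∧ ∀ t : ℝ, 0 ≤ t → y t = σ.C *ᵥ x t

/-- Words of length at most `n - 1` in the letters `A` (`none`) and `N_j` (`some j`). -/
abbrev Word (n m : ℕ) : Type := Σ k : Fin n, (Fin k → Option (Fin m))

/-- The matrix denoted by a letter. -/
def letter (σ : BDS n m p) : Option (Fin m) → Matrix (Fin n) (Fin n) ℝ
  | none => σ.A
  | some j => σ.N j

/-- The matrix product `A_{i_1} ⋯ A_{i_k}` spelled by a word. -/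
def wordProd (σ : BDS n m p) (w : Word n m) : Matrix (Fin n) (Fin n) ℝ :=
  (List.ofFn fun i => σ.letter (w.2 i)).prod

/-- The bilinear controllability matrix, with columns `A_{i_1} ⋯ A_{i_k} b`, `k ≤ n - 1`. -/
def controllabilityMatrix (σ : BDS n m p) : Matrix (Fin n) (Word n m) ℝ :=
  Matrix.of fun i w => (σ.wordProd w *ᵥ σ.b) i

/-- The bilinear observability matrix, with rows `C_q A_{i_1} ⋯ A_{i_k}`, `k ≤ n - 1`,
where `C_q` is the `q`-th row of `C`. -/
def observabilityMatrix (σ : BDS n m p) : Matrix (Word n m × Fin p) (Fin n) ℝ :=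
  Matrix.of fun wq i => (σ.C wq.2 ᵥ* σ.wordProd wq.1) i

/-- Similarity: the two systems differ by a linear change of the state variable. -/
def Similar (σ σ' : BDS n m p) : Prop :=
  ∃ T : Matrix (Fin n) (Fin n) ℝ, IsUnit T.det ∧
    σ'.A = T⁻¹ * σ.A * T ∧ (∀ j, σ'.N j = T⁻¹ * σ.N j * T) ∧
    σ'.b = T⁻¹ *ᵥ σ.b ∧ σ'.C = σ.C * T

/-- Two systems cannot be told apart by probing them with the inputs of the class `U` and
sampling the outputs uniformly, at the times `0, Δ, 2Δ, …`. -/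
def Indistinguishable (U : Set (ℝ → Fin m → ℝ)) (Δ : ℝ) (σ σ' : BDS n m p) : Prop :=
  ∀ u ∈ U, ∀ y y', σ.IsOutput u y → σ'.IsOutput u y' →
    ∀ k : ℕ, y (k * Δ) = y' (k * Δ)

end BDS

/-- The rectangular pulse of width `τ` with control vector `a`. -/
def pulse {m : ℕ} (a : Fin m → ℝ) (τ : ℝ) : ℝ → Fin m → ℝ :=
  fun t => if 0 ≤ t ∧ t < τ then a else 0

/-- The pulses of fixed amplitude `α` and arbitrary width `τ ≥ 0`. The control is vector valued,
so the pulse vector is `α` times a unit vector `e`. -/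
def pulseFamily (m : ℕ) (α : ℝ) : Set (ℝ → Fin m → ℝ) :=
  {u | ∃ (e : Fin m → ℝ) (τ : ℝ), ∑ j, e j ^ 2 = 1 ∧ 0 ≤ τ ∧ u = pulse (α • e) τ}

/-- Orthonormal traceless Hermitian generators `F_1, …, F_{N² - 1}`: an orthonormal basis of
`𝔰𝔲(N)` up to the factor `i`. -/
structure GeneratorBasis (N : ℕ) where
  F : Fin (N ^ 2 - 1) → Matrix (Fin N) (Fin N) ℂ
  isHermitian : ∀ j, (F j).IsHermitian
  trace_eq_zero : ∀ j, (F j).trace = 0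
  orthonormal : ∀ j k, (F j * F k).trace = if j = k then 1 else 0

namespace GeneratorBasis

variable {N : ℕ} (B : GeneratorBasis N)

/-- Antisymmetric structure constants, the coefficients in `[F_j, F_k] = i ∑ l, f_{jkl} F_l`. -/
def f (j k l : Fin (N ^ 2 - 1)) : ℝ :=
  (-Complex.I * ((B.F j * B.F k - B.F k * B.F j) * B.F l).trace).re

/-- Symmetric structure constants, the coefficients in
`{F_j, F_k} = (2 / N) δ_{jk} 1 + ∑ l, g_{jkl} F_l`. -/
def g (j k l : Fin (N ^ 2 - 1)) : ℝ :=
  ((B.F j * B.F k + B.F k * B.F j) * B.F l).trace.re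

/-- `z_{jkl} = f_{jkl} + i g_{jkl}`. -/
def z (j k l : Fin (N ^ 2 - 1)) : ℂ := B.f j k l + Complex.I * B.g j k l

/-- The dissipation tensor
`D^{(j,k)}_{lm} = (1/4) ∑ r, (z_{lrk} f_{jmr} + conj z_{mrk} f_{jlr})`. -/
def D (j k l m : Fin (N ^ 2 - 1)) : ℂ :=
  (1 / 4) * ∑ r, (B.z l r k * B.f j m r + (starRingEnd ℂ) (B.z m r k) * B.f j l r)

/-- The matrix of `θ ↦ vec A^{(l)}(θ)`; pairs of indices serve as the vectorised index. -/
def T₁ : Matrix (Fin (N ^ 2 - 1) × Fin (N ^ 2 - 1)) (Fin (N ^ 2 - 1)) ℂ :=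
  Matrix.of fun jk l => -(B.f jk.1 jk.2 l : ℂ)

/-- The matrix of `γ ↦ vec A^{(d)}(γ)`, where `γ` is the Kossakowski matrix. -/
def T₂ : Matrix (Fin (N ^ 2 - 1) × Fin (N ^ 2 - 1)) (Fin (N ^ 2 - 1) × Fin (N ^ 2 - 1)) ℂ :=
  Matrix.of fun jk lm => -B.D jk.1 jk.2 lm.1 lm.2

/-- The parameter reconstruction matrix `M = [T₁ T₂; 0 (i / N) T₁ᵀ]`. -/
def M : Matrix ((Fin (N ^ 2 - 1) × Fin (N ^ 2 - 1)) ⊕ Fin (N ^ 2 - 1))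
    (Fin (N ^ 2 - 1) ⊕ (Fin (N ^ 2 - 1) × Fin (N ^ 2 - 1))) ℂ :=
  Matrix.fromBlocks B.T₁ B.T₂ 0 ((Complex.I / N) • B.T₁ᵀ)

end GeneratorBasis

/-- Invertibility of a square matrix whose rows and columns carry different labels. -/
def MatrixInvertible {ι κ : Type*} [Fintype ι] [Fintype κ] [DecidableEq ι] [DecidableEq κ]
    (X : Matrix ι κ ℂ) : Prop :=
  ∃ Y : Matrix κ ι ℂ, X * Y = 1 ∧ Y * X = 1

/-- A closed `N`-level quantum system with `p` measured observables: the traceless drift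
Hamiltonian `H`, the initial density matrix `ρ₀` and the traceless observables `O_q`. It is
driven through `H + ∑ k, u_k(t) F_k` for a given family of generators `F_k`. -/
structure ClosedQuantumSystem (N p : ℕ) where
  H : Matrix (Fin N) (Fin N) ℂ
  H_isHermitian : H.IsHermitian
  H_trace : H.trace = 0
  ρ₀ : Matrix (Fin N) (Fin N) ℂ
  ρ₀_posSemidef : ρ₀.PosSemidef
  ρ₀_trace : ρ₀.trace = 1
  O : Fin p → Matrix (Fin N) (Fin N) ℂ
  O_isHermitian : ∀ q, (O q).IsHermitian
  O_trace : ∀ q, (O q).trace = 0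

namespace ClosedQuantumSystem

variable {N p : ℕ}

/-- The coordinates `θ_l = Tr (F_l H)` of the Hamiltonian `H = ∑ l, θ_l F_l`. -/
def θ (S : ClosedQuantumSystem N p) (B : GeneratorBasis N) (l : Fin (N ^ 2 - 1)) : ℝ :=
  (B.F l * S.H).trace.re

/-- The BDS form of the measurement dynamics: the state is the coherence vector
`x_j = Tr (F_j ρ)`, with `A_{jk} = - ∑ l, θ_l f_{jkl}`, `(N_j)_{kl} = - f_{jkl}`,
`b_j = Tr (F_j ρ₀)`, and `C_{qk}` the coefficient of `F_k` in `O_q`. -/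
def bds (S : ClosedQuantumSystem N p) (B : GeneratorBasis N) :
    BDS (N ^ 2 - 1) (N ^ 2 - 1) p where
  A := Matrix.of fun j k => -∑ l, S.θ B l * B.f j k l
  N := fun j => Matrix.of fun k l => -B.f j k l
  b := fun j => (B.F j * S.ρ₀).trace.re
  C := Matrix.of fun q k => (B.F k * S.O q).trace.re

end ClosedQuantumSystem

end

/-! Pulses of width `τ ≤ Δ`, sampled once at time `Δ`, already suffice. The output `C exp((Δ-τ)A)
exp(τ(A + ∑ a_j N_j)) b` has `τ`-derivatives `C exp(ΔA) R_k b` at `τ = 0`, where `R_k` is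
`responseCoeff`. Let `β` be the traceless Hermitian matrix with coordinates `b`, and `γ` the one of
a row of `C exp(ΔA)`. The generators become `-i` times commutators, so indistinguishable systems
share all numbers `Tr(γ R_k(β))`, for each control on the sphere of radius `|α|`
(`trace_responseCoeff_eq`). Separating parities in the control, homogenising and complexifying turns
these into identities in complex traceless matrices.

Drift: take `X = u vᵀ` with `v ⬝ u = 0`. Up to constants, order 2 yields `(v ⬝ βu)(v ⬝ γu)` and the
odd part of order 4 yields `(v ⬝ Hu)(v ⬝ βu)(v ⬝ γu)`. If `H' ≠ H`, some such `X` detects `β`, `γ`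
and `H' - H` simultaneously, a contradiction (`ResponseEq.drift_eq`).

State and output: once the drifts agree, orders 2 and 3 determine `β ⊗ γ` (`tensor_eq`). Hence `b`
and `C` are fixed up to reciprocal real scalars, and the similarity is a scalar matrix. Full rank
supplies `b ≠ 0` and `C ≠ 0`. For the reconstruction, `(θ, 0)` solves the linear system because `T₁
θ = vec A`; invertibility of `M` makes it unique. -/

noncomputable section

/-! ### Pulse responses of a bilinear system -/

section Flows

open scoped Matrix.Norms.Operator

variable {n m p : ℕ}

theorem hasDerivAt_exp_smul_matrix (X : Matrix (Fin n) (Fin n) ℝ) (t : ℝ) :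
    HasDerivAt (fun s : ℝ => NormedSpace.exp (s • X)) (X * NormedSpace.exp (t • X)) t :=
  hasDerivAt_exp_smul_const' X t

theorem continuous_exp_smul_matrix (X : Matrix (Fin n) (Fin n) ℝ) :
    Continuous fun s : ℝ => NormedSpace.exp (s • X) :=
  continuous_iff_continuousAt.2 fun t => (hasDerivAt_exp_smul_matrix X t).continuousAt

theorem HasDerivAt.mulVec_const {f : ℝ → Matrix (Fin n) (Fin m) ℝ} {f' : Matrix (Fin n) (Fin m) ℝ}
    {t : ℝ} (hf : HasDerivAt f f' t) (v : Fin m → ℝ) :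
    HasDerivAt (fun s => f s *ᵥ v) (f' *ᵥ v) t := by
  let φ : Matrix (Fin n) (Fin m) ℝ →ₗ[ℝ] (Fin n → ℝ) := (Matrix.mulVecBilin ℝ ℝ).flip v
  exact (LinearMap.toContinuousLinearMap φ).hasFDerivAt.comp_hasDerivAt t hf

end Flows

namespace BDS

variable {n m p : ℕ}

/-- The state trajectory for the pulse with control vector `a` and width `τ`. -/
def pulseTrajectory (σ : BDS n m p) (a : Fin m → ℝ) (τ t : ℝ) : Fin n → ℝ :=
  (NormedSpace.exp ((t - min t τ) • σ.A) * NormedSpace.exp (min t τ • σ.generator a)) *ᵥ σ.b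

theorem generator_zero (σ : BDS n m p) : σ.generator 0 = σ.A := by
  simp [generator]

theorem continuous_pulseTrajectory (σ : BDS n m p) (a : Fin m → ℝ) (τ : ℝ) :
    Continuous (σ.pulseTrajectory a τ) := by
  have h1 := (continuous_exp_smul_matrix σ.A).comp
    (show Continuous fun t : ℝ => t - min t τ by fun_prop)
  have h2 := (continuous_exp_smul_matrix (σ.generator a)).comp
    (show Continuous fun t : ℝ => min t τ by fun_prop)
  exact (h1.matrix_mul h2).matrix_mulVec continuous_const

theorem hasDerivAt_pulseTrajectory (σ : BDS n m p) (a : Fin m → ℝ) {τ t : ℝ}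
    (h0 : 0 < t) (ht : t ≠ τ) :
    HasDerivAt (σ.pulseTrajectory a τ)
      (σ.generator (pulse a τ t) *ᵥ σ.pulseTrajectory a τ t) t := by
  rcases lt_or_gt_of_ne ht with h | h
  · have hd := (hasDerivAt_exp_smul_matrix (σ.generator a) t).mulVec_const σ.b
    have hp : pulse a τ t = a := by simp [pulse, h0.le, h]
    have hx : ∀ s, s < τ →
        σ.pulseTrajectory a τ s = NormedSpace.exp (s • σ.generator a) *ᵥ σ.b := by
      intro s hs
      simp [pulseTrajectory, min_eq_left hs.le]
    rw [hp, hx t h, Matrix.mulVec_mulVec]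
    refine hd.congr_of_eventuallyEq ?_
    filter_upwards [Iio_mem_nhds h] with s hs using hx s hs
  · have hp : pulse a τ t = 0 := by simp [pulse, h.le]
    have hx : ∀ s, τ < s → σ.pulseTrajectory a τ s =
        NormedSpace.exp ((s - τ) • σ.A) *ᵥ
          (NormedSpace.exp (τ • σ.generator a) *ᵥ σ.b) := by
      intro s hs
      simp [pulseTrajectory, min_eq_right hs.le]
    have hd := ((hasDerivAt_exp_smul_matrix σ.A (t - τ)).mulVec_const
      (NormedSpace.exp (τ • σ.generator a) *ᵥ σ.b)).comp_sub_const t τ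
    rw [hp, generator_zero, hx t h, Matrix.mulVec_mulVec]
    refine hd.congr_of_eventuallyEq ?_
    filter_upwards [Ioi_mem_nhds h] with s hs using hx s hs

theorem intervalIntegrable_pulseTrajectory (σ : BDS n m p) (a : Fin m → ℝ) (τ t : ℝ) :
    IntervalIntegrable
      (fun s => σ.generator (pulse a τ s) *ᵥ σ.pulseTrajectory a τ s)
      MeasureTheory.volume 0 t := by
  have hx := σ.continuous_pulseTrajectory a τ
  have h1 : Continuous fun s => σ.A *ᵥ σ.pulseTrajectory a τ s :=
    continuous_const.matrix_mulVec hx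
  have h2 : Continuous fun s => (∑ j, a j • σ.N j) *ᵥ σ.pulseTrajectory a τ s :=
    continuous_const.matrix_mulVec hx
  have h3 : (fun s => σ.generator (pulse a τ s) *ᵥ σ.pulseTrajectory a τ s) =
      fun s => σ.A *ᵥ σ.pulseTrajectory a τ s +
        (Set.Ico 0 τ).indicator
          (fun s => (∑ j, a j • σ.N j) *ᵥ σ.pulseTrajectory a τ s) s := by
    funext s
    by_cases hs : 0 ≤ s ∧ s < τ
    · have : s ∈ Set.Ico 0 τ := hs
      simp [pulse, hs, this, generator, Matrix.add_mulVec]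
    · have : s ∉ Set.Ico 0 τ := hs
      simp [pulse, hs, this, generator]
  rw [h3]
  refine (h1.intervalIntegrable 0 t).add ?_
  exact ⟨(h2.intervalIntegrable 0 t).1.indicator measurableSet_Ico,
    (h2.intervalIntegrable 0 t).2.indicator measurableSet_Ico⟩

theorem isTrajectory_pulseTrajectory (σ : BDS n m p) (a : Fin m → ℝ) {τ : ℝ} (hτ : 0 ≤ τ) :
    σ.IsTrajectory (pulse a τ) (σ.pulseTrajectory a τ) := by
  refine ⟨(σ.continuous_pulseTrajectory a τ).continuousOn, fun t ht =>
    ⟨σ.intervalIntegrable_pulseTrajectory a τ t, ?_⟩⟩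
  -- The input jumps at `τ`; the fundamental theorem of calculus tolerates this one exceptional
  -- point.
  rw [MeasureTheory.integral_eq_of_hasDerivAt_off_countable (σ.pulseTrajectory a τ) _
    (Set.countable_singleton τ) (σ.continuous_pulseTrajectory a τ).continuousOn ?_
    (σ.intervalIntegrable_pulseTrajectory a τ t)]
  · simp [pulseTrajectory, min_eq_left hτ]
  · rintro s ⟨hs, hsτ⟩
    rw [min_eq_left ht] at hs
    exact σ.hasDerivAt_pulseTrajectory a hs.1 hsτ

/-- The response, sampled at the time `Δ`, to the pulses of width at most `Δ`. -/
theorem Indistinguishable.sample_eq {σ σ' : BDS n m p} {α Δ : ℝ} (hα : α ≠ 0)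
    (h : Indistinguishable (pulseFamily m α) Δ σ σ') {a : Fin m → ℝ}
    (ha : ∑ j, a j ^ 2 = α ^ 2) {τ : ℝ} (hτ : 0 ≤ τ) (hτΔ : τ ≤ Δ) :
    σ.C *ᵥ ((NormedSpace.exp ((Δ - τ) • σ.A) * NormedSpace.exp (τ • σ.generator a)) *ᵥ σ.b) =
    σ'.C *ᵥ ((NormedSpace.exp ((Δ - τ) • σ'.A) * NormedSpace.exp (τ • σ'.generator a)) *ᵥ
      σ'.b) := by
  have hu : pulse a τ ∈ pulseFamily m α := by
    refine ⟨α⁻¹ • a, τ, ?_, hτ, by rw [smul_inv_smul₀ hα]⟩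
    simp only [Pi.smul_apply, smul_eq_mul, mul_pow, ← Finset.mul_sum, ha]
    field_simp
  -- All outputs are quantified over, so exhibiting one trajectory per system is enough; the final
  -- `1` selects the sample at time `Δ`.
  have := h _ hu (fun t => σ.C *ᵥ σ.pulseTrajectory a τ t)
    (fun t => σ'.C *ᵥ σ'.pulseTrajectory a τ t)
    ⟨_, σ.isTrajectory_pulseTrajectory a hτ, fun _ _ => rfl⟩
    ⟨_, σ'.isTrajectory_pulseTrajectory a hτ, fun _ _ => rfl⟩ 1
  simpa [pulseTrajectory, min_eq_right hτΔ] using this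

end BDS

/-! ### Taylor coefficients in the pulse width -/

/-- The derivatives at `0` of `t ↦ exp (-t A) * exp (t X)`. -/
def responseCoeff {R : Type*} [Ring R] (X A : R) : ℕ → R
  | 0 => 1
  | k + 1 => responseCoeff X A k * X - A * responseCoeff X A k

section Flows

open scoped Matrix.Norms.Operator

variable {n p : ℕ}

/-- By the product rule only the middle factor changes, by `M ↦ M X - A M`. This is the recursion of
`responseCoeff`, so it can be iterated. -/
theorem hasDerivAt_exp_mul_mul_exp (A X M : Matrix (Fin n) (Fin n) ℝ) (Δ t : ℝ) :
    HasDerivAt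
      (fun s : ℝ => NormedSpace.exp ((Δ - s) • A) * M * NormedSpace.exp (s • X))
      (NormedSpace.exp ((Δ - t) • A) * (M * X - A * M) * NormedSpace.exp (t • X)) t := by
  have h1 : HasDerivAt (fun s : ℝ => NormedSpace.exp ((Δ - s) • A))
      (-(NormedSpace.exp ((Δ - t) • A) * A)) t :=
    (hasDerivAt_exp_smul_const A (Δ - t)).comp_const_sub Δ t
  have h2 := (h1.mul_const M).mul (hasDerivAt_exp_smul_matrix X t)
  refine h2.congr_deriv ?_
  noncomm_ring

theorem continuous_exp_mul_mul_exp (A X M : Matrix (Fin n) (Fin n) ℝ) (Δ : ℝ) :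
    Continuous
      (fun s : ℝ => NormedSpace.exp ((Δ - s) • A) * M * NormedSpace.exp (s • X)) :=
  continuous_iff_continuousAt.2 fun t => (hasDerivAt_exp_mul_mul_exp A X M Δ t).continuousAt

theorem HasDerivAt.const_mulVec {f : ℝ → Fin n → ℝ} {f' : Fin n → ℝ} {t : ℝ}
    (hf : HasDerivAt f f' t) (C : Matrix (Fin p) (Fin n) ℝ) :
    HasDerivAt (fun s => C *ᵥ f s) (C *ᵥ f') t :=
  (LinearMap.toContinuousLinearMap (Matrix.mulVecLin C)).hasFDerivAt.comp_hasDerivAt t hf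

theorem responseCoeff_mulVec_eq {A X A' X' : Matrix (Fin n) (Fin n) ℝ}
    {C C' : Matrix (Fin p) (Fin n) ℝ} {b b' : Fin n → ℝ} {Δ : ℝ} (hΔ : 0 < Δ)
    (h : ∀ t, 0 ≤ t → t ≤ Δ →
      C *ᵥ ((NormedSpace.exp ((Δ - t) • A) * NormedSpace.exp (t • X)) *ᵥ b) =
      C' *ᵥ ((NormedSpace.exp ((Δ - t) • A') * NormedSpace.exp (t • X')) *ᵥ b')) (k : ℕ) :
    (C * NormedSpace.exp (Δ • A)) *ᵥ (responseCoeff X A k *ᵥ b) =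
    (C' * NormedSpace.exp (Δ • A')) *ᵥ (responseCoeff X' A' k *ᵥ b') := by
  -- Differentiation takes place in the open interval, where the equality holds near each point;
  -- continuity then carries it to `t = 0`.
  have key : ∀ k, ∀ t ∈ Set.Ioo 0 Δ,
      C *ᵥ ((NormedSpace.exp ((Δ - t) • A) * responseCoeff X A k *
        NormedSpace.exp (t • X)) *ᵥ b) =
      C' *ᵥ ((NormedSpace.exp ((Δ - t) • A') * responseCoeff X' A' k *
        NormedSpace.exp (t • X')) *ᵥ b') := by
    intro k
    induction k with
    | zero => intro t ht; simpa [responseCoeff] using h t ht.1.le ht.2.le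
    | succ k ih =>
      intro t ht
      have h1 := ((hasDerivAt_exp_mul_mul_exp A X (responseCoeff X A k) Δ t).mulVec_const
        b).const_mulVec C
      have h2 := ((hasDerivAt_exp_mul_mul_exp A' X' (responseCoeff X' A' k) Δ t).mulVec_const
        b').const_mulVec C'
      refine h1.unique (h2.congr_of_eventuallyEq ?_)
      filter_upwards [Ioo_mem_nhds ht.1 ht.2] with s hs using ih s hs
  have hc : ∀ (A X M : Matrix (Fin n) (Fin n) ℝ) (C : Matrix (Fin p) (Fin n) ℝ) (b : Fin n → ℝ),
      Continuous fun t : ℝ => C *ᵥ ((NormedSpace.exp ((Δ - t) • A) * M *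
        NormedSpace.exp (t • X)) *ᵥ b) := fun A X M C b =>
    continuous_const.matrix_mulVec
      ((continuous_exp_mul_mul_exp A X M Δ).matrix_mulVec continuous_const)
  have hcl := (isClosed_eq (hc A X (responseCoeff X A k) C b)
    (hc A' X' (responseCoeff X' A' k) C' b')).closure_subset_iff.2 (key k)
  rw [closure_Ioo hΔ.ne] at hcl
  have h0 := hcl (Set.left_mem_Icc.2 hΔ.le)
  simpa [Matrix.mulVec_mulVec, Matrix.mul_assoc] using h0

end Flows

/-! ### Commutators and coherence coordinates -/

/-- The commutator `Y ↦ X Y - Y X` as a linear operator. -/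
def commutatorMap {ι : Type*} [Fintype ι] (X : Matrix ι ι ℂ) : Module.End ℂ (Matrix ι ι ℂ) :=
  LinearMap.mulLeft ℂ X - LinearMap.mulRight ℂ X

section CommutatorMap

variable {ι : Type*} [Fintype ι]

theorem commutatorMap_apply (X Y : Matrix ι ι ℂ) : commutatorMap X Y = X * Y - Y * X := rfl

theorem commutatorMap_add (X Y : Matrix ι ι ℂ) :
    commutatorMap (X + Y) = commutatorMap X + commutatorMap Y := by
  ext1 Z
  simp only [commutatorMap_apply, LinearMap.add_apply]
  noncomm_ring

theorem commutatorMap_smul (c : ℂ) (X : Matrix ι ι ℂ) :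
    commutatorMap (c • X) = c • commutatorMap X := by
  ext1 Z
  simp [commutatorMap_apply, smul_sub]

theorem commutatorMap_neg (X : Matrix ι ι ℂ) : commutatorMap (-X) = -commutatorMap X := by
  ext1 Z
  simp only [commutatorMap_apply, LinearMap.neg_apply]
  noncomm_ring

end CommutatorMap

theorem responseCoeff_smul {R : Type*} [Ring R] [Algebra ℂ R] (c : ℂ) (X A : R) (k : ℕ) :
    responseCoeff (c • X) (c • A) k = c ^ k • responseCoeff X A k := by
  induction k with
  | zero => simp [responseCoeff]
  | succ k ih =>
    simp only [responseCoeff, ih, pow_succ, smul_sub, mul_smul_comm, smul_mul_assoc, smul_smul]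
    rw [mul_comm c]

namespace GeneratorBasis

variable {N : ℕ} (B : GeneratorBasis N)

/-- The matrix with a given coherence vector. -/
def mat (v : Fin (N ^ 2 - 1) → ℝ) : Matrix (Fin N) (Fin N) ℂ := ∑ j, (v j : ℂ) • B.F j

theorem mat_add (v w : Fin (N ^ 2 - 1) → ℝ) : B.mat (v + w) = B.mat v + B.mat w := by
  simp [mat, add_smul, Finset.sum_add_distrib]

theorem mat_smul (c : ℝ) (v : Fin (N ^ 2 - 1) → ℝ) : B.mat (c • v) = (c : ℂ) • B.mat v := by
  simp [mat, Finset.smul_sum, mul_smul]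

theorem mat_neg (v : Fin (N ^ 2 - 1) → ℝ) : B.mat (-v) = -B.mat v := by
  simp [mat]

theorem mat_sub (v w : Fin (N ^ 2 - 1) → ℝ) : B.mat (v - w) = B.mat v - B.mat w := by
  simp [mat, sub_smul]

theorem trace_mat (v : Fin (N ^ 2 - 1) → ℝ) : (B.mat v).trace = 0 := by
  simp [mat, Matrix.trace_sum, B.trace_eq_zero]

theorem trace_F_mul_sum (c : Fin (N ^ 2 - 1) → ℂ) (k : Fin (N ^ 2 - 1)) :
    (B.F k * ∑ j, c j • B.F j).trace = c k := by
  simp [Finset.mul_sum, Matrix.trace_sum, B.orthonormal]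

theorem trace_F_mul_mat (v : Fin (N ^ 2 - 1) → ℝ) (k : Fin (N ^ 2 - 1)) :
    (B.F k * B.mat v).trace = v k :=
  B.trace_F_mul_sum _ k

theorem trace_mat_mul_mat (v w : Fin (N ^ 2 - 1) → ℝ) :
    (B.mat v * B.mat w).trace = (v ⬝ᵥ w : ℝ) := by
  rw [mat, Finset.sum_mul, Matrix.trace_sum, dotProduct]
  simp [trace_F_mul_mat]

theorem mat_injective : Function.Injective B.mat := fun v w h => by
  funext k
  have := B.trace_F_mul_mat v k
  rw [h, B.trace_F_mul_mat w k] at this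
  exact_mod_cast this.symm

/-- The coordinates of a matrix with respect to the generators and the identity. -/
def coordMap : Matrix (Fin N) (Fin N) ℂ →ₗ[ℂ] (Fin (N ^ 2 - 1) → ℂ) × ℂ :=
  (LinearMap.pi fun j => (Matrix.traceLinearMap (Fin N) ℂ ℂ).comp
    (LinearMap.mulLeft ℂ (B.F j))).prod (Matrix.traceLinearMap (Fin N) ℂ ℂ)

theorem coordMap_apply (X : Matrix (Fin N) (Fin N) ℂ) :
    B.coordMap X = (fun j => (B.F j * X).trace, X.trace) := rfl

/-- Orthonormality gives explicit preimages, hence surjectivity, and `N² = (N² - 1) + 1` is the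
dimension count. It fails for `N = 0` because of truncated subtraction. -/
theorem coordMap_injective : Function.Injective B.coordMap := by
  rcases Nat.eq_zero_or_pos N with rfl | hN
  · exact Function.injective_of_subsingleton _
  have hfr : Module.finrank ℂ (Matrix (Fin N) (Fin N) ℂ) =
      Module.finrank ℂ ((Fin (N ^ 2 - 1) → ℂ) × ℂ) := by
    have : 1 ≤ N ^ 2 := Nat.one_le_pow _ _ hN
    simp [Module.finrank_matrix]
    rw [← sq]
    omega
  rw [LinearMap.injective_iff_surjective_of_finrank_eq_finrank hfr]
  rintro ⟨c, d⟩
  refine ⟨∑ j, c j • B.F j + (d / N) • (1 : Matrix (Fin N) (Fin N) ℂ), ?_⟩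
  have hN' : (N : ℂ) ≠ 0 := by exact_mod_cast hN.ne'
  rw [coordMap_apply]
  refine Prod.ext (funext fun k => ?_) ?_
  · simp [mul_add, B.trace_F_mul_sum, B.trace_eq_zero]
  · simp [Matrix.trace_sum, B.trace_eq_zero, hN']

theorem eq_sum_of_trace_eq_zero {X : Matrix (Fin N) (Fin N) ℂ} (hX : X.trace = 0) :
    X = ∑ j, (B.F j * X).trace • B.F j := by
  apply B.coordMap_injective
  rw [coordMap_apply, coordMap_apply]
  refine Prod.ext (funext fun k => ?_) ?_
  · simp [B.trace_F_mul_sum]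
  · simp [Matrix.trace_sum, B.trace_eq_zero, hX]

theorem im_trace_mul_eq_zero {X Y : Matrix (Fin N) (Fin N) ℂ} (hX : X.IsHermitian)
    (hY : Y.IsHermitian) : (X * Y).trace.im = 0 := by
  rw [← Complex.conj_eq_iff_im]
  have := Matrix.trace_conjTranspose (X * Y)
  rw [Matrix.conjTranspose_mul, hX.eq, hY.eq, Matrix.trace_mul_comm] at this
  exact this.symm

theorem eq_mat_of_isHermitian {X : Matrix (Fin N) (Fin N) ℂ} (hX : X.IsHermitian)
    (h0 : X.trace = 0) : X = B.mat fun j => (B.F j * X).trace.re := by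
  refine (B.eq_sum_of_trace_eq_zero h0).trans (Finset.sum_congr rfl fun j _ => ?_)
  congr 1
  exact Complex.ext rfl (by simpa using im_trace_mul_eq_zero (B.isHermitian j) hX)

/-- The real part in the definition of `f` loses nothing: the commutator of Hermitian matrices is
skew-Hermitian, so the trace times `-i` is real. -/
theorem neg_f_eq (j k l : Fin (N ^ 2 - 1)) :
    ((-B.f j k l : ℝ) : ℂ) =
      (B.F k * (-Complex.I • (B.F j * B.F l - B.F l * B.F j))).trace := by
  have h1 : (B.F k * (-Complex.I • (B.F j * B.F l - B.F l * B.F j))).trace =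
      -(-Complex.I * ((B.F j * B.F k - B.F k * B.F j) * B.F l).trace) := by
    have e1 : (B.F k * (B.F j * B.F l)).trace = (B.F k * B.F j * B.F l).trace := by
      rw [Matrix.mul_assoc]
    have e2 : (B.F k * (B.F l * B.F j)).trace = (B.F j * B.F k * B.F l).trace := by
      rw [← Matrix.mul_assoc, Matrix.trace_mul_cycle]
    rw [Matrix.mul_smul, Matrix.trace_smul, Matrix.mul_sub, Matrix.sub_mul, Matrix.trace_sub,
      Matrix.trace_sub, e1, e2, smul_eq_mul]
    ring
  have h2 : (starRingEnd ℂ) ((B.F j * B.F k - B.F k * B.F j) * B.F l).trace =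
      -((B.F j * B.F k - B.F k * B.F j) * B.F l).trace := by
    have := Matrix.trace_conjTranspose ((B.F j * B.F k - B.F k * B.F j) * B.F l)
    rw [Matrix.conjTranspose_mul, Matrix.conjTranspose_sub, Matrix.conjTranspose_mul,
      Matrix.conjTranspose_mul, (B.isHermitian j).eq, (B.isHermitian k).eq, (B.isHermitian l).eq,
      Matrix.trace_mul_comm, ← neg_sub (B.F j * B.F k), Matrix.neg_mul, Matrix.trace_neg] at this
    exact this.symm
  have h3 : (-Complex.I * ((B.F j * B.F k - B.F k * B.F j) * B.F l).trace).im = 0 := by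
    rw [← Complex.conj_eq_iff_im, map_mul, h2, map_neg, Complex.conj_I]
    ring
  rw [h1, Complex.ofReal_neg]
  congr 1
  exact Complex.ext rfl (by simpa using h3.symm)

theorem f_rotate (j k l : Fin (N ^ 2 - 1)) : B.f j k l = B.f l j k := by
  have e1 : (B.F j * B.F k * B.F l).trace = (B.F l * B.F j * B.F k).trace := by
    rw [Matrix.trace_mul_cycle]
  have e2 : (B.F k * B.F j * B.F l).trace = (B.F j * B.F l * B.F k).trace := by
    rw [Matrix.trace_mul_cycle, Matrix.trace_mul_cycle]
  rw [f, f, Matrix.sub_mul, Matrix.sub_mul, Matrix.trace_sub, Matrix.trace_sub, e1, e2]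

/-- The adjoint action of the matrix with coherence vector `y`, in coordinates. -/
def adMatrix (y : Fin (N ^ 2 - 1) → ℝ) : Matrix (Fin (N ^ 2 - 1)) (Fin (N ^ 2 - 1)) ℝ :=
  ∑ j, y j • Matrix.of fun k l => -B.f j k l

/-- The dictionary between the real coordinate dynamics and commutators of complex matrices. -/
theorem mat_adMatrix_mulVec (y v : Fin (N ^ 2 - 1) → ℝ) :
    B.mat (B.adMatrix y *ᵥ v) = (-Complex.I • commutatorMap (B.mat y)) (B.mat v) := by
  have ht : ((-Complex.I • commutatorMap (B.mat y)) (B.mat v)).trace = 0 := by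
    rw [LinearMap.smul_apply, commutatorMap_apply, Matrix.trace_smul, Matrix.trace_sub,
      Matrix.trace_mul_comm, sub_self, smul_zero]
  rw [B.eq_sum_of_trace_eq_zero ht]
  refine Finset.sum_congr rfl fun k _ => ?_
  congr 1
  have h1 : (B.adMatrix y *ᵥ v) k = ∑ l, ∑ j, y j * v l * -B.f j k l := by
    simp only [adMatrix, Matrix.mulVec, dotProduct, Matrix.sum_apply, Matrix.smul_apply,
      Matrix.of_apply, smul_eq_mul, Finset.sum_mul]
    exact Finset.sum_congr rfl fun l _ => Finset.sum_congr rfl fun j _ => by ring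
  rw [h1]
  push_cast [← B.neg_f_eq]
  have h2 : ∀ j k l, (-(B.f j k l : ℂ)) =
      (B.F k * (-Complex.I • (B.F j * B.F l - B.F l * B.F j))).trace := fun j k l => by
    rw [← B.neg_f_eq, Complex.ofReal_neg]
  simp only [h2, LinearMap.smul_apply, commutatorMap_apply]
  simp only [mat, Finset.sum_mul, Finset.mul_sum, Matrix.mul_smul, Matrix.smul_mul,
    Matrix.trace_smul, Matrix.trace_sub, Matrix.trace_sum, smul_eq_mul, mul_sub,
    Finset.sum_sub_distrib]
  congr 1
  · exact Finset.sum_congr rfl fun j _ => Finset.sum_congr rfl fun l _ => by ring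
  · rw [Finset.sum_comm]
    exact Finset.sum_congr rfl fun j _ => Finset.sum_congr rfl fun l _ => by ring

theorem mat_responseCoeff_mulVec (x a v : Fin (N ^ 2 - 1) → ℝ) (k : ℕ) :
    B.mat (responseCoeff (B.adMatrix x) (B.adMatrix a) k *ᵥ v) =
      (-Complex.I) ^ k •
        responseCoeff (commutatorMap (B.mat x)) (commutatorMap (B.mat a)) k (B.mat v) := by
  rw [← LinearMap.smul_apply, ← responseCoeff_smul]
  induction k generalizing v with
  | zero => simp [responseCoeff]
  | succ k ih =>
    simp only [responseCoeff, Matrix.sub_mulVec, ← Matrix.mulVec_mulVec, mat_sub,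
      mat_adMatrix_mulVec, ih, LinearMap.sub_apply, Module.End.mul_apply]

end GeneratorBasis

namespace ClosedQuantumSystem

variable {N p : ℕ} (S : ClosedQuantumSystem N p) (B : GeneratorBasis N)

theorem bds_A : (S.bds B).A = B.adMatrix (S.θ B) := by
  ext j k
  simp only [bds, GeneratorBasis.adMatrix, Matrix.of_apply, Matrix.sum_apply, Matrix.smul_apply,
    smul_eq_mul, mul_neg, Finset.sum_neg_distrib]
  -- `A` sums over the last index of `f` and `adMatrix` over the first.
  exact congrArg _ (Finset.sum_congr rfl fun l _ => by rw [B.f_rotate j k l])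

theorem bds_generator (a : Fin (N ^ 2 - 1) → ℝ) :
    (S.bds B).generator a = B.adMatrix (a + S.θ B) := by
  rw [BDS.generator, bds_A, add_comm]
  simp only [GeneratorBasis.adMatrix, Pi.add_apply, add_smul, Finset.sum_add_distrib]
  rfl

theorem mat_θ : B.mat (S.θ B) = S.H :=
  (B.eq_mat_of_isHermitian S.H_isHermitian S.H_trace).symm

/-- The effective output matrix after free evolution for the time `Δ`. -/
def sampledOutput (Δ : ℝ) : Matrix (Fin p) (Fin (N ^ 2 - 1)) ℝ :=
  (S.bds B).C * NormedSpace.exp (Δ • (S.bds B).A)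

theorem trace_responseCoeff_eq {S S' : ClosedQuantumSystem N p} {B : GeneratorBasis N} {α Δ : ℝ}
    (hα : α ≠ 0) (hΔ : 0 < Δ)
    (h : BDS.Indistinguishable (pulseFamily (N ^ 2 - 1) α) Δ (S.bds B) (S'.bds B))
    {a : Fin (N ^ 2 - 1) → ℝ} (ha : ∑ j, a j ^ 2 = α ^ 2) (q : Fin p) (k : ℕ) :
    (B.mat (S.sampledOutput B Δ q) * responseCoeff (commutatorMap (B.mat a) + commutatorMap S.H)
      (commutatorMap S.H) k (B.mat (S.bds B).b)).trace =
    (B.mat (S'.sampledOutput B Δ q) * responseCoeff (commutatorMap (B.mat a) + commutatorMap S'.H)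
      (commutatorMap S'.H) k (B.mat (S'.bds B).b)).trace := by
  have h1 := congrFun (responseCoeff_mulVec_eq hΔ (fun t h0 h1 => h.sample_eq hα ha h0 h1) k) q
  have h2 : ∀ S : ClosedQuantumSystem N p,
      (((((S.bds B).C * NormedSpace.exp (Δ • (S.bds B).A)) *ᵥ
        (responseCoeff ((S.bds B).generator a) (S.bds B).A k *ᵥ (S.bds B).b)) q : ℝ) : ℂ) =
      (-Complex.I) ^ k * (B.mat (S.sampledOutput B Δ q) *
        responseCoeff (commutatorMap (B.mat a) + commutatorMap S.H)
          (commutatorMap S.H) k (B.mat (S.bds B).b)).trace := fun S => by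
    rw [← smul_eq_mul, ← Matrix.trace_smul, ← Matrix.mul_smul, ← commutatorMap_add, ← S.mat_θ B,
      ← B.mat_add, ← B.mat_responseCoeff_mulVec, B.trace_mat_mul_mat, bds_generator, ← bds_A]
    rfl
  have h3 := (h2 S).symm.trans ((congrArg _ h1).trans (h2 S'))
  -- Both systems carry the same factor `(-i)^k`, which cancels.
  exact mul_left_cancel₀ (pow_ne_zero _ (neg_ne_zero.2 Complex.I_ne_zero)) h3

end ClosedQuantumSystem

/-! ### Polynomial identities: complexification and polarization -/

section Polarization

variable {V : Type*} [AddCommGroup V] [Module ℂ V]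

/-- Linearity in each of the three arguments. -/
structure IsTrilinear (T : V → V → V → ℂ) : Prop where
  fst : ∀ (t : ℂ) (x x' y z : V), T (x + t • x') y z = T x y z + t * T x' y z
  snd : ∀ (t : ℂ) (x y y' z : V), T x (y + t • y') z = T x y z + t * T x y' z
  trd : ∀ (t : ℂ) (x y z z' : V), T x y (z + t • z') = T x y z + t * T x y z'

/-- Polynomial of degree at most three along every line. -/
def IsCubic (R : V → ℂ) : Prop :=
  ∀ x y, ∃ c₀ c₁ c₂ c₃ : ℂ, ∀ t : ℂ, R (x + t • y) = c₀ + c₁ * t + c₂ * t ^ 2 + c₃ * t ^ 3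

theorem IsTrilinear.isCubic {T : V → V → V → ℂ} (hT : IsTrilinear T) :
    IsCubic fun x => T x x x := fun x y =>
  ⟨T x x x, T y x x + T x y x + T x x y, T y y x + T y x y + T x y y, T y y y, fun t => by
    simp only [hT.fst, hT.snd, hT.trd]
    ring⟩

/-- The four real points `0, 1, -1, 2` already force the cubic's coefficients to vanish. -/
theorem IsCubic.eq_zero_of_forall_real {R : V → ℂ} (hR : IsCubic R) (x y : V)
    (h : ∀ t : ℝ, R (x + (t : ℂ) • y) = 0) (t : ℂ) : R (x + t • y) = 0 := by
  obtain ⟨c₀, c₁, c₂, c₃, hc⟩ := hR x y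
  have h0 := (hc (0 : ℝ)).symm.trans (h 0)
  have h1 := (hc (1 : ℝ)).symm.trans (h 1)
  have h2 := (hc (-1 : ℝ)).symm.trans (h (-1))
  have h3 := (hc (2 : ℝ)).symm.trans (h 2)
  push_cast at h0 h1 h2 h3
  have e0 : c₀ = 0 := by linear_combination h0
  have e2 : c₂ = 0 := by linear_combination (h1 + h2) / 2 - h0
  have e3 : c₃ = 0 := by linear_combination h3 / 6 - h1 / 2 + h0 / 2 - h2 / 6
  have e1 : c₁ = 0 := by linear_combination h1 - e0 - e2 - e3
  rw [hc, e0, e1, e2, e3]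
  ring

theorem IsTrilinear.eq_zero_of_symm {T : V → V → V → ℂ} (hT : IsTrilinear T)
    (h12 : ∀ x y z, T x y z = T y x z) (h23 : ∀ x y z, T x y z = T x z y)
    (h : ∀ x, T x x x = 0) (x y z : V) : T x y z = 0 := by
  have hxy : ∀ x y, T x x y = 0 := by
    intro x y
    have h1 := h (x + (1 : ℂ) • y)
    have h2 := h (x + (-1 : ℂ) • y)
    simp only [hT.fst, hT.snd, hT.trd, h] at h1 h2
    have e1 := h23 x y x
    have e2 := h12 y x x
    linear_combination h1 / 6 - h2 / 6 - 2 * e1 / 3 - e2 / 3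
  have h1 := hxy (x + (1 : ℂ) • y) z
  simp only [hT.fst, hT.snd, hxy] at h1
  linear_combination h1 / 2 - h12 y x z / 2

end Polarization

/-- A traceless matrix is `P + iQ` with `P, Q` Hermitian and traceless; vanishing at `P + tQ` for
real `t` extends to `t = i`. -/
theorem GeneratorBasis.eq_zero_of_forall_mat {N : ℕ} (B : GeneratorBasis N)
    {R : Matrix (Fin N) (Fin N) ℂ → ℂ} (hR : IsCubic R) (h : ∀ v, R (B.mat v) = 0)
    {X : Matrix (Fin N) (Fin N) ℂ} (hX : X.trace = 0) : R X = 0 := by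
  have hX' : X = B.mat (fun j => (B.F j * X).trace.re) +
      Complex.I • B.mat (fun j => (B.F j * X).trace.im) := by
    conv_lhs => rw [B.eq_sum_of_trace_eq_zero hX]
    rw [mat, mat, Finset.smul_sum, ← Finset.sum_add_distrib]
    refine Finset.sum_congr rfl fun j _ => ?_
    rw [smul_smul, ← add_smul, mul_comm, Complex.re_add_im]
  rw [hX']
  refine hR.eq_zero_of_forall_real _ _ (fun t => ?_) _
  rw [← B.mat_smul, ← B.mat_add]
  exact h _

/-! ### Parity parts of the coefficients and trace pairings -/

section Response

variable {R : Type*} [Ring R] (E A : R)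

theorem responseCoeff_one : responseCoeff (E + A) A 1 = E := by
  simp [responseCoeff]

/-- For the arguments `E + A` and `A` the recursion reads `R_{k+1} = R_k E + ⁅R_k, A⁆`. Combining
`E` with `-E` isolates one parity in the control. -/
theorem responseCoeff_two_even :
    responseCoeff (E + A) A 2 + responseCoeff (-E + A) A 2 = E * E + E * E := by
  simp only [responseCoeff]
  noncomm_ring

theorem responseCoeff_three_odd :
    responseCoeff (E + A) A 3 - responseCoeff (-E + A) A 3 =
      2 * (E * E * E + ⁅⁅E, A⁆, A⁆) := by
  simp only [responseCoeff, Ring.lie_def]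
  noncomm_ring

theorem responseCoeff_four_odd :
    responseCoeff (E + A) A 4 - responseCoeff (-E + A) A 4 =
      2 * (3 * (⁅E, A⁆ * E * E) + 2 * (E * ⁅E, A⁆ * E) + E * E * ⁅E, A⁆ + ⁅⁅⁅E, A⁆, A⁆, A⁆) := by
  simp only [responseCoeff, Ring.lie_def]
  noncomm_ring

end Response

section Pairing

variable {ι : Type*} [Fintype ι]

theorem commutatorMap_lie (X Y : Matrix ι ι ℂ) :
    ⁅commutatorMap X, commutatorMap Y⁆ = commutatorMap ⁅X, Y⁆ := by
  ext1 Z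
  simp only [Ring.lie_def, LinearMap.sub_apply, Module.End.mul_apply, commutatorMap_apply]
  noncomm_ring

theorem commutatorMap_sub (X Y : Matrix ι ι ℂ) :
    commutatorMap (X - Y) = commutatorMap X - commutatorMap Y := by
  rw [sub_eq_add_neg, commutatorMap_add, commutatorMap_neg, ← sub_eq_add_neg]

/-- The functional `W ↦ Tr (γ W(β))`. -/
def pairing (γ β : Matrix ι ι ℂ) : Module.End ℂ (Matrix ι ι ℂ) →ₗ[ℂ] ℂ :=
  (Matrix.traceLinearMap ι ℂ ℂ).comp ((LinearMap.mulLeft ℂ γ).comp (LinearMap.applyₗ β))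

theorem pairing_apply (γ β : Matrix ι ι ℂ) (W : Module.End ℂ (Matrix ι ι ℂ)) :
    pairing γ β W = (γ * W β).trace := rfl

/-- The part of the fourth response coefficient that is cubic in the control. -/
def cubicForm (γ β a x y z : Matrix ι ι ℂ) : ℂ :=
  pairing γ β ((3 : ℂ) • (commutatorMap ⁅x, a⁆ * commutatorMap y * commutatorMap z) +
    (2 : ℂ) • (commutatorMap x * commutatorMap ⁅y, a⁆ * commutatorMap z) +
    commutatorMap x * commutatorMap y * commutatorMap ⁅z, a⁆)

theorem isTrilinear_cubicForm (γ β a : Matrix ι ι ℂ) : IsTrilinear (cubicForm γ β a) := by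
  constructor <;> intros <;>
  · simp only [cubicForm, Ring.lie_def, commutatorMap_add, commutatorMap_sub, commutatorMap_smul,
      add_mul, mul_add, sub_mul, mul_sub, smul_mul_assoc, mul_smul_comm, map_add, map_sub,
      map_smul, smul_eq_mul]
    ring

theorem isTrilinear_pairing (γ β : Matrix ι ι ℂ) : IsTrilinear fun x y z =>
    pairing γ β (commutatorMap x * commutatorMap y * commutatorMap z) := by
  constructor <;> intros <;>
  · simp only [commutatorMap_add, commutatorMap_smul, add_mul,
      mul_add, smul_mul_assoc, mul_smul_comm, map_add, map_smul, smul_eq_mul]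

variable {x a β γ : Matrix ι ι ℂ} {s t : ℂ}

/-- Here `⁅x, ⁅x, β⁆⁆ = -2t x` and `⁅⁅x, a⁆, x⁆ = 2s x`. The three weighted summands contribute
`-12`, `0` and `4` times `s t Tr(γx)`. -/
theorem cubicForm_of_mul_self_eq_zero (hx : x * x = 0) (ha : x * (a * x) = s • x)
    (hβ : x * (β * x) = t • x) : cubicForm γ β a x x x = -8 * (s * t * (γ * x).trace) := by
  have hx' : ∀ w, x * (x * w) = 0 := fun w => by rw [← mul_assoc, hx, zero_mul]
  have ha' : ∀ w, x * (a * (x * w)) = s • (x * w) := fun w => by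
    rw [← smul_mul_assoc, ← ha, mul_assoc, mul_assoc]
  have hβ' : ∀ w, x * (β * (x * w)) = t • (x * w) := fun w => by
    rw [← smul_mul_assoc, ← hβ, mul_assoc, mul_assoc]
  simp only [cubicForm, pairing_apply, LinearMap.add_apply, LinearMap.smul_apply,
    Module.End.mul_apply, commutatorMap_apply, Ring.lie_def, mul_sub, sub_mul, mul_assoc, hx, hx',
    ha, ha', hβ, hβ', mul_zero, zero_mul, smul_zero, mul_smul_comm, smul_mul_assoc, Matrix.mul_add,
    Matrix.trace_add, Matrix.trace_sub, Matrix.trace_smul, Matrix.trace_zero, smul_eq_mul]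
  ring

theorem pairing_of_mul_self_eq_zero (hx : x * x = 0) (hβ : x * (β * x) = t • x) :
    pairing γ β (commutatorMap x * commutatorMap x) = -2 * (t * (γ * x).trace) := by
  have hx' : ∀ w, x * (x * w) = 0 := fun w => by rw [← mul_assoc, hx, zero_mul]
  simp only [pairing_apply, Module.End.mul_apply, commutatorMap_apply, mul_sub, sub_mul,
    mul_assoc, hx, hx', hβ, mul_zero, mul_smul_comm, Matrix.trace_sub, Matrix.trace_smul,
    Matrix.trace_zero, smul_eq_mul]
  ring

end Pairing

/-! ### Recovering `β ⊗ γ` from commutator pairings -/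

section MatrixTensor

variable {ι : Type*} [Fintype ι]

theorem Matrix.eq_of_forall_trace_mul {X Y : Matrix ι ι ℂ}
    (h : ∀ P : Matrix ι ι ℂ, (P * X).trace = (P * Y).trace) : X = Y :=
  Matrix.ext_iff_trace_mul_left.2 h

variable [DecidableEq ι]

theorem Matrix.eq_zero_of_forall_commute {c : Matrix ι ι ℂ} (hc : c.trace = 0)
    (h : ∀ Z, Z * c = c * Z) : c = 0 := by
  rcases isEmpty_or_nonempty ι with hι | hι
  · exact Subsingleton.elim _ _
  obtain ⟨r, rfl⟩ := Matrix.mem_range_scalar_iff_commute_single'.2 fun i j => h _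
  have : r = 0 := by simpa using hc
  simp [this]

variable {β γ β' γ' : Matrix ι ι ℂ}

/-- Cyclicity of the trace moves `x` outside, so `⁅⁅Y, β⁆, γ⁆` is determined. On matrix units this
is the symmetrised tensor plus correction terms, which partial traces show to be equal for both
pairs. -/
theorem symm_tensor_eq (hβ : β.trace = 0) (hγ : γ.trace = 0) (hβ' : β'.trace = 0)
    (hγ' : γ'.trace = 0)
    (h : ∀ x y, pairing γ β (commutatorMap x * commutatorMap y) =
      pairing γ' β' (commutatorMap x * commutatorMap y)) (P : Matrix ι ι ℂ) :
    (P * β).trace • γ + (P * γ).trace • β = (P * β').trace • γ' + (P * γ').trace • β' := by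
  rcases isEmpty_or_nonempty ι with hι | hι
  · exact Subsingleton.elim _ _
  have h1 : ∀ Y : Matrix ι ι ℂ, (Y * β - β * Y) * γ - γ * (Y * β - β * Y) =
      (Y * β' - β' * Y) * γ' - γ' * (Y * β' - β' * Y) := by
    intro Y
    refine Matrix.eq_of_forall_trace_mul fun X => ?_
    have e : ∀ γ B : Matrix ι ι ℂ,
        (X * (B * γ - γ * B)).trace = (γ * (X * B - B * X)).trace := by
      intro γ B
      rw [mul_sub, mul_sub, Matrix.trace_sub, Matrix.trace_sub, ← mul_assoc X B,
        Matrix.trace_mul_comm (X * B), Matrix.trace_mul_comm X (γ * B), mul_assoc γ B X]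
    rw [e, e]
    exact h X Y
  have h2 : ∀ i a b j, (if i = a then (β * γ) b j - (β' * γ') b j else 0) +
      (if b = j then (γ * β) i a - (γ' * β') i a else 0) =
      β i a * γ b j + γ i a * β b j - (β' i a * γ' b j + γ' i a * β' b j) := by
    intro i a b j
    have e : ∀ β γ : Matrix ι ι ℂ, ((Matrix.single a b 1 * β - β * Matrix.single a b 1) * γ -
        γ * (Matrix.single a b 1 * β - β * Matrix.single a b 1) : Matrix ι ι ℂ) i j =
        (if i = a then (β * γ) b j else 0) - β i a * γ b j - γ i a * β b j +
          (if b = j then (γ * β) i a else 0) := by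
      intro β γ
      rw [sub_mul, mul_sub, mul_assoc, mul_assoc, ← mul_assoc γ, ← mul_assoc γ]
      simp only [Matrix.sub_apply, Matrix.mul_apply, Matrix.single_apply]
      by_cases h1 : i = a <;> by_cases h2 : b = j <;>
        simp [h1, h2, ite_and, eq_comm, Finset.mul_sum] <;> ring
    have := congrFun (congrFun (h1 (Matrix.single a b 1)) i) j
    rw [e, e] at this
    split_ifs at this ⊢ <;> linear_combination this
  have hn : (Fintype.card ι : ℂ) ≠ 0 := by exact_mod_cast Fintype.card_ne_zero
  -- Contracting `b = j` kills the tensor terms, since all four matrices are traceless; `h4`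
  -- contracts `i = a` likewise.
  have h3 : ∀ i a, (if i = a then (β * γ).trace - (β' * γ').trace else 0) +
      Fintype.card ι * ((γ * β) i a - (γ' * β') i a) = 0 := by
    intro i a
    have := Finset.sum_congr rfl fun b (_ : b ∈ Finset.univ) => h2 i a b b
    simp only [Finset.sum_add_distrib, Finset.sum_sub_distrib, ← Finset.mul_sum] at this
    simp only [Matrix.trace, Matrix.diag] at hβ hγ hβ' hγ' ⊢
    rw [hβ, hγ, hβ', hγ'] at this
    by_cases h : i = a
    · simp [h, mul_sub, Finset.sum_sub_distrib] at this ⊢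
      linear_combination this
    · simp only [h, if_false] at this ⊢
      simp at this
      linear_combination this
  have h4 : ∀ b j, (Fintype.card ι : ℂ) * ((β * γ) b j - (β' * γ') b j) +
      (if b = j then (γ * β).trace - (γ' * β').trace else 0) = 0 := by
    intro b j
    have := Finset.sum_congr rfl fun i (_ : i ∈ Finset.univ) => h2 i i b j
    simp only [Finset.sum_add_distrib, Finset.sum_sub_distrib, ← Finset.sum_mul] at this
    simp only [Matrix.trace, Matrix.diag] at hβ hγ hβ' hγ' ⊢
    rw [hβ, hγ, hβ', hγ'] at this
    by_cases h : b = j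
    · simp [h, mul_sub, Finset.sum_sub_distrib] at this ⊢
      linear_combination this
    · simp only [h, if_false] at this ⊢
      simp at this
      linear_combination this
  have h5 : (β * γ).trace - (β' * γ').trace + ((γ * β).trace - (γ' * β').trace) = 0 := by
    have := Finset.sum_congr rfl fun i (_ : i ∈ Finset.univ) => h3 i i
    simp only [if_true, Finset.sum_add_distrib, ← Finset.mul_sum, Finset.sum_sub_distrib] at this
    refine mul_left_cancel₀ hn ?_
    simpa [Matrix.trace, mul_add, mul_sub] using this
  have h6 : ∀ i a b j, β i a * γ b j + γ i a * β b j = β' i a * γ' b j + γ' i a * β' b j := by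
    intro i a b j
    rw [← sub_eq_zero, ← h2]
    refine mul_left_cancel₀ hn ?_
    have e3 := h3 i a
    have e4 := h4 b j
    split_ifs at e3 e4 ⊢
    · linear_combination e3 + e4 - h5
    · linear_combination e4
    · linear_combination e3
    · simp
  ext b j
  have h7 : ∀ β γ : Matrix ι ι ℂ, ((P * β).trace • γ + (P * γ).trace • β) b j =
      ∑ a, ∑ i, P a i * (β i a * γ b j + γ i a * β b j) := by
    intro β γ
    simp only [Matrix.trace, Matrix.diag, Matrix.mul_apply, Matrix.add_apply, Matrix.smul_apply,
      smul_eq_mul, Finset.sum_mul, mul_add, Finset.sum_add_distrib, mul_assoc]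
  rw [h7, h7]
  simp only [h6]

/-- The difference `s` of the two tensors is antisymmetric by the quadratic identity. The cubic
identity makes each commutator map self-adjoint for `s`. But a commutator of self-adjoint maps is
skew, so by Jacobi `s` kills iterated brackets, and these detect every traceless matrix. -/
theorem tensor_eq (hβ : β.trace = 0) (hγ : γ.trace = 0) (hβ' : β'.trace = 0)
    (hγ' : γ'.trace = 0)
    (h₂ : ∀ x y, pairing γ β (commutatorMap x * commutatorMap y) =
      pairing γ' β' (commutatorMap x * commutatorMap y))
    (h₃ : ∀ x y z, pairing γ β (commutatorMap x * commutatorMap y * commutatorMap z) =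
      pairing γ' β' (commutatorMap x * commutatorMap y * commutatorMap z)) (Q : Matrix ι ι ℂ) :
    (Q * γ).trace • β = (Q * γ').trace • β' := by
  let s : Matrix ι ι ℂ → Matrix ι ι ℂ → ℂ := fun P Q =>
    (P * β).trace * (Q * γ).trace - (P * β').trace * (Q * γ').trace
  have hs : ∀ P Q, s P Q = (P * β).trace * (Q * γ).trace - (P * β').trace * (Q * γ').trace :=
    fun _ _ => rfl
  have anti : ∀ P Q, s P Q = -s Q P := by
    intro P Q
    have := congrArg (fun X => (Q * X).trace) (symm_tensor_eq hβ hγ hβ' hγ' h₂ P)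
    simp only [mul_add, Matrix.mul_smul, Matrix.trace_add, Matrix.trace_smul, smul_eq_mul] at this
    rw [hs, hs]
    linear_combination this
  have htr : ∀ Z β : Matrix ι ι ℂ, (Z * β - β * Z).trace = 0 := fun Z β => by
    rw [Matrix.trace_sub, Matrix.trace_mul_comm, sub_self]
  have hmove : ∀ P Z β : Matrix ι ι ℂ,
      (P * (Z * β - β * Z)).trace = ((P * Z - Z * P) * β).trace := by
    intro P Z β
    rw [mul_sub, sub_mul, Matrix.trace_sub, Matrix.trace_sub, ← mul_assoc, ← mul_assoc,
      Matrix.trace_mul_cycle P β Z]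
  -- The symmetric statement is applied with `⁅Z, β⁆` in place of `β`, then combined with
  -- antisymmetry.
  have inv : ∀ P Q Z, s (P * Z - Z * P) Q = s P (Q * Z - Z * Q) := by
    intro P Q Z
    have := congrArg (fun X => (Q * X).trace) (symm_tensor_eq (htr Z β) hγ (htr Z β') hγ'
      (fun x y => h₃ x y Z) P)
    simp only [mul_add, Matrix.mul_smul, Matrix.trace_add, Matrix.trace_smul, smul_eq_mul,
      hmove] at this
    rw [anti P, hs, hs]
    linear_combination this
  have sub_left : ∀ P P' Q, s (P - P') Q = s P Q - s P' Q := fun P P' Q => by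
    simp only [hs, sub_mul, Matrix.trace_sub]; ring
  have sub_right : ∀ P Q Q', s P (Q - Q') = s P Q - s P Q' := fun P Q Q' => by
    simp only [hs, sub_mul, Matrix.trace_sub]; ring
  have zero : ∀ P Q Z W, s (P * (Z * W - W * Z) - (Z * W - W * Z) * P) Q = 0 := by
    intro P Q Z W
    have jac : ∀ P : Matrix ι ι ℂ, P * (Z * W - W * Z) - (Z * W - W * Z) * P =
        ((P * Z - Z * P) * W - W * (P * Z - Z * P)) -
          ((P * W - W * P) * Z - Z * (P * W - W * P)) := fun P => by noncomm_ring
    have h1 := inv P Q (Z * W - W * Z)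
    have h2 : s (P * (Z * W - W * Z) - (Z * W - W * Z) * P) Q =
        -s P (Q * (Z * W - W * Z) - (Z * W - W * Z) * Q) := by
      rw [jac P, jac Q, sub_left, sub_right, inv, inv, inv, inv]
      ring
    rw [← h1] at h2
    linear_combination h2 / 2
  rw [← sub_eq_zero]
  set c := (Q * γ).trace • β - (Q * γ').trace • β' with hc
  have hc0 : c.trace = 0 := by simp [hc, hβ, hβ']
  have hsc : ∀ P, (P * c).trace = s P Q := by
    intro P
    rw [hc, hs, mul_sub, Matrix.mul_smul, Matrix.mul_smul, Matrix.trace_sub, Matrix.trace_smul,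
      Matrix.trace_smul, smul_eq_mul, smul_eq_mul]
    ring
  -- A traceless central matrix is zero; this is used for `c`, then for its commutators with
  -- arbitrary `P`.
  refine Matrix.eq_zero_of_forall_commute hc0 fun P => ?_
  rw [← sub_eq_zero]
  refine Matrix.eq_zero_of_forall_commute (htr P c) fun Z => ?_
  rw [← sub_eq_zero]
  refine Matrix.eq_of_forall_trace_mul fun W => ?_
  rw [hmove, mul_zero, Matrix.trace_zero]
  have := zero P Q W Z
  rw [← hsc, ← neg_sub, neg_mul, Matrix.trace_neg, neg_eq_zero, ← hmove] at this
  exact this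

end MatrixTensor

/-! ### Generic rank one nilpotent test matrices -/

section NilpotentTests

variable {ι : Type*} [Fintype ι]

/-- The polynomial `(K - Kᵀ) u ⬝ M u` in the entries of `u` and `K`. -/
def isotropicPoly (M : Matrix ι ι ℂ) : MvPolynomial (ι ⊕ ι × ι) ℂ :=
  ∑ i, ∑ j, (MvPolynomial.X (Sum.inr (i, j)) - MvPolynomial.X (Sum.inr (j, i))) *
    MvPolynomial.X (Sum.inl j) * ∑ k, MvPolynomial.C (M i k) * MvPolynomial.X (Sum.inl k)

theorem eval_isotropicPoly (M K : Matrix ι ι ℂ) (u : ι → ℂ) :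
    MvPolynomial.eval (Sum.elim u fun ij => K ij.1 ij.2) (isotropicPoly M) =
      ((K - Kᵀ) *ᵥ u) ⬝ᵥ (M *ᵥ u) := by
  simp [isotropicPoly, Matrix.mulVec, dotProduct, Finset.sum_mul]

variable [DecidableEq ι]

/-- Taking `K` a matrix unit, vanishing would make `M u` parallel to `u` for all `u`. Then `M` is
scalar, and zero by tracelessness. -/
theorem isotropicPoly_ne_zero {M : Matrix ι ι ℂ} (hM : M ≠ 0) (h0 : M.trace = 0) :
    isotropicPoly M ≠ 0 := by
  intro h
  have h1 : ∀ (i j : ι) (u : ι → ℂ), u j * (M *ᵥ u) i - u i * (M *ᵥ u) j = 0 := by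
    intro i j u
    have := eval_isotropicPoly M (Matrix.single i j 1) u
    rw [h, map_zero, Matrix.transpose_single, Matrix.sub_mulVec, sub_dotProduct,
      Matrix.single_mulVec, Matrix.single_mulVec] at this
    have e : ∀ (i : ι) (c : ℂ) (w : ι → ℂ), Function.update 0 i c ⬝ᵥ w = c * w i :=
      fun i c w => single_dotProduct w c i
    simpa [e] using this.symm
  refine hM (Matrix.eq_zero_of_forall_commute h0 ?_)
  have hoff : ∀ i j, i ≠ j → M i j = 0 := by
    intro i j hij
    have := h1 i j (Pi.single j 1)
    simpa [hij] using this
  have hdiag : ∀ i j, M i i = M j j := by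
    intro i j
    by_cases hij : i = j
    · rw [hij]
    have := h1 i j (Pi.single i 1 + Pi.single j 1)
    simp [Matrix.mulVec_add, hij, Ne.symm hij, hoff i j hij, hoff j i (Ne.symm hij)] at this
    linear_combination this
  intro Z
  ext i j
  rw [Matrix.mul_apply, Matrix.mul_apply, Finset.sum_eq_single j, Finset.sum_eq_single i,
    hdiag i j, mul_comm]
  · intro k _ hk
    rw [hoff _ _ hk.symm, zero_mul]
  · simp
  · intro k _ hk
    rw [hoff _ _ hk, mul_zero]
  · simp

/-- Finitely many nonzero traceless matrices are detected by a common rank one nilpotent. -/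
theorem exists_isotropic_pair {M₁ M₂ M₃ : Matrix ι ι ℂ} (h₁ : M₁ ≠ 0) (h₂ : M₂ ≠ 0) (h₃ : M₃ ≠ 0)
    (t₁ : M₁.trace = 0) (t₂ : M₂.trace = 0) (t₃ : M₃.trace = 0) :
    ∃ u v : ι → ℂ, v ⬝ᵥ u = 0 ∧
      (v ⬝ᵥ (M₁ *ᵥ u)) * (v ⬝ᵥ (M₂ *ᵥ u)) * (v ⬝ᵥ (M₃ *ᵥ u)) ≠ 0 := by
  have hp := mul_ne_zero (mul_ne_zero (isotropicPoly_ne_zero h₁ t₁) (isotropicPoly_ne_zero h₂ t₂))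
    (isotropicPoly_ne_zero h₃ t₃)
  obtain ⟨x, hx⟩ : ∃ x, MvPolynomial.eval x
      (isotropicPoly M₁ * isotropicPoly M₂ * isotropicPoly M₃) ≠ 0 := by
    by_contra! hcon
    exact hp (MvPolynomial.funext fun x => by rw [hcon x, map_zero])
  let u : ι → ℂ := fun i => x (Sum.inl i)
  let K : Matrix ι ι ℂ := Matrix.of fun i j => x (Sum.inr (i, j))
  have hxe : x = Sum.elim u fun ij => K ij.1 ij.2 := by
    funext i
    cases i <;> rfl
  rw [hxe, map_mul, map_mul, eval_isotropicPoly, eval_isotropicPoly, eval_isotropicPoly] at hx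
  -- Skew-symmetry makes `v ⬝ u = 0` automatic, so the constraint is parametrised by free variables
  -- and a product of nonzero polynomials has a nonzero value.
  refine ⟨u, (K - Kᵀ) *ᵥ u, ?_, hx⟩
  rw [Matrix.sub_mulVec, sub_dotProduct, Matrix.mulVec_transpose, ← Matrix.dotProduct_mulVec,
    dotProduct_comm, sub_self]

end NilpotentTests

/-! ### Comparing the responses of two systems -/

section Linearity

variable {V : Type*} [AddCommGroup V] [Module ℂ V]

theorem IsTrilinear.sub {T T' : V → V → V → ℂ} (hT : IsTrilinear T) (hT' : IsTrilinear T') :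
    IsTrilinear fun x y z => T x y z - T' x y z := by
  constructor <;> intros
  · rw [hT.fst, hT'.fst]; ring
  · rw [hT.snd, hT'.snd]; ring
  · rw [hT.trd, hT'.trd]; ring

theorem IsTrilinear.add {T T' : V → V → V → ℂ} (hT : IsTrilinear T) (hT' : IsTrilinear T') :
    IsTrilinear fun x y z => T x y z + T' x y z := by
  constructor <;> intros
  · rw [hT.fst, hT'.fst]; ring
  · rw [hT.snd, hT'.snd]; ring
  · rw [hT.trd, hT'.trd]; ring

theorem IsTrilinear.cubic_smul {T : V → V → V → ℂ} (hT : IsTrilinear T) (c : ℂ) (x : V) :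
    T (c • x) (c • x) (c • x) = c ^ 3 * T x x x := by
  have h1 : ∀ y z, T 0 y z = 0 := fun y z => by simpa using hT.fst 1 0 0 y z
  have h2 : ∀ x z, T x 0 z = 0 := fun x z => by simpa using hT.snd 1 x 0 0 z
  have h3 : ∀ x y, T x y 0 = 0 := fun x y => by simpa using hT.trd 1 x y 0 0
  have e1 := hT.fst c 0 x (c • x) (c • x)
  have e2 := hT.snd c x 0 x (c • x)
  have e3 := hT.trd c x x 0 x
  simp only [h1, h2, h3, zero_add] at e1 e2 e3
  rw [e1, e2, e3]
  ring

end Linearity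

theorem commutatorMap_sub_smul_one {ι : Type*} [Fintype ι] [DecidableEq ι] (X : Matrix ι ι ℂ)
    (c : ℂ) : commutatorMap (X - c • 1) = commutatorMap X := by
  ext1 Y
  simp only [commutatorMap_apply, sub_mul, mul_sub, smul_mul_assoc, mul_smul_comm, one_mul, mul_one]
  abel

namespace GeneratorBasis

variable {N : ℕ} (B : GeneratorBasis N)

/-- A homogeneous cubic or lower degree polynomial vanishing on the Hermitian traceless matrices
of a fixed norm vanishes on all traceless matrices. -/
theorem eq_zero_of_forall_sphere {R : Matrix (Fin N) (Fin N) ℂ → ℂ} {d : ℕ} (hd : d ≠ 0)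
    (hR : IsCubic R) (hhom : ∀ c X, R (c • X) = c ^ d * R X) {α : ℝ} (hα : α ≠ 0)
    (h : ∀ a, ∑ j, a j ^ 2 = α ^ 2 → R (B.mat a) = 0)
    {X : Matrix (Fin N) (Fin N) ℂ} (hX : X.trace = 0) : R X = 0 := by
  refine B.eq_zero_of_forall_mat hR (fun y => ?_) hX
  by_cases hy : y = 0
  · have h0 : B.mat y = (0 : ℂ) • B.mat y := by simp [hy, mat]
    rw [h0, hhom, zero_pow hd, zero_mul]
  have hpos : 0 < ∑ j, y j ^ 2 := by
    obtain ⟨j, hj⟩ := Function.ne_iff.1 hy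
    exact Finset.sum_pos' (fun j _ => sq_nonneg _) ⟨j, Finset.mem_univ _,
      lt_of_le_of_ne (sq_nonneg _) (pow_ne_zero 2 hj).symm⟩
  set t : ℝ := |α| / √(∑ j, y j ^ 2) with ht
  have ht0 : t ≠ 0 := div_ne_zero (abs_ne_zero.2 hα) (Real.sqrt_pos.2 hpos).ne'
  have hsum : ∑ j, (t • y) j ^ 2 = α ^ 2 := by
    simp only [Pi.smul_apply, smul_eq_mul, mul_pow, ← Finset.mul_sum]
    rw [ht, div_pow, sq_abs, Real.sq_sqrt hpos.le, div_mul_cancel₀ _ hpos.ne']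
  have := h _ hsum
  rw [B.mat_smul, hhom] at this
  exact (mul_eq_zero.1 this).resolve_left (pow_ne_zero _ (by exact_mod_cast ht0))

section Response

variable {B} {β γ β' γ' H H' : Matrix (Fin N) (Fin N) ℂ} {α : ℝ}

/-- Equality of all response coefficients, for all controls of norm `|α|`. -/
def ResponseEq (B : GeneratorBasis N) (α : ℝ) (β γ H β' γ' H' : Matrix (Fin N) (Fin N) ℂ) : Prop :=
  ∀ a, ∑ j, a j ^ 2 = α ^ 2 → ∀ k,
    pairing γ β (responseCoeff (commutatorMap (B.mat a) + commutatorMap H) (commutatorMap H) k) =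
    pairing γ' β' (responseCoeff (commutatorMap (B.mat a) + commutatorMap H') (commutatorMap H') k)

theorem ResponseEq.neg (h : ResponseEq B α β γ H β' γ' H') {a : Fin (N ^ 2 - 1) → ℝ}
    (ha : ∑ j, a j ^ 2 = α ^ 2) (k : ℕ) :
    pairing γ β (responseCoeff (-commutatorMap (B.mat a) + commutatorMap H)
      (commutatorMap H) k) =
    pairing γ' β' (responseCoeff (-commutatorMap (B.mat a) + commutatorMap H')
      (commutatorMap H') k) := by
  rw [← commutatorMap_neg, ← B.mat_neg]
  exact h (-a) (by simpa using ha) k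

/-- Scalar matrices are central, so identities for traceless matrices extend to all matrices. -/
theorem exists_traceless_commutatorMap_eq (hN : N ≠ 0) (X : Matrix (Fin N) (Fin N) ℂ) :
    ∃ X₀ : Matrix (Fin N) (Fin N) ℂ, X₀.trace = 0 ∧ commutatorMap X₀ = commutatorMap X := by
  have hN' : (N : ℂ) ≠ 0 := by exact_mod_cast hN
  exact ⟨X - (X.trace / N) • 1, by simp [hN'], commutatorMap_sub_smul_one X _⟩

theorem ResponseEq.pairing_one (h : ResponseEq B α β γ H β' γ' H') (hN : N ≠ 0) (hα : α ≠ 0)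
    (X : Matrix (Fin N) (Fin N) ℂ) :
    pairing γ β (commutatorMap X) = pairing γ' β' (commutatorMap X) := by
  obtain ⟨X₀, hX₀, hX⟩ := exists_traceless_commutatorMap_eq hN X
  rw [← hX, ← sub_eq_zero]
  refine B.eq_zero_of_forall_sphere
    (R := fun X => pairing γ β (commutatorMap X) - pairing γ' β' (commutatorMap X))
    one_ne_zero (fun x y => ⟨pairing γ β (commutatorMap x) - pairing γ' β' (commutatorMap x),
      pairing γ β (commutatorMap y) - pairing γ' β' (commutatorMap y), 0, 0, fun t => ?_⟩) (fun c X => ?_) hα (fun a ha => ?_) hX₀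
  · simp only [commutatorMap_add, commutatorMap_smul, map_add, map_smul, smul_eq_mul]
    ring
  · simp only [commutatorMap_smul, map_smul, smul_eq_mul]
    ring
  · have := h a ha 1
    rw [responseCoeff_one, responseCoeff_one] at this
    exact sub_eq_zero.2 this

theorem ResponseEq.pairing_two (h : ResponseEq B α β γ H β' γ' H') (hN : N ≠ 0) (hα : α ≠ 0)
    (X Y : Matrix (Fin N) (Fin N) ℂ) :
    pairing γ β (commutatorMap X * commutatorMap Y) =
      pairing γ' β' (commutatorMap X * commutatorMap Y) := by
  have hsq : ∀ X : Matrix (Fin N) (Fin N) ℂ, pairing γ β (commutatorMap X * commutatorMap X) =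
      pairing γ' β' (commutatorMap X * commutatorMap X) := by
    intro X
    obtain ⟨X₀, hX₀, hX⟩ := exists_traceless_commutatorMap_eq hN X
    rw [← hX, ← sub_eq_zero]
    refine B.eq_zero_of_forall_sphere
      (R := fun X => pairing γ β (commutatorMap X * commutatorMap X) -
        pairing γ' β' (commutatorMap X * commutatorMap X))
      two_ne_zero (fun x y => ⟨pairing γ β (commutatorMap x * commutatorMap x) -
        pairing γ' β' (commutatorMap x * commutatorMap x),
        pairing γ β (commutatorMap x * commutatorMap y + commutatorMap y * commutatorMap x) -
        pairing γ' β' (commutatorMap x * commutatorMap y + commutatorMap y * commutatorMap x),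
        pairing γ β (commutatorMap y * commutatorMap y) -
        pairing γ' β' (commutatorMap y * commutatorMap y), 0, fun t => ?_⟩)
      (fun c X => ?_) hα (fun a ha => ?_) hX₀
    · simp only [commutatorMap_add, commutatorMap_smul, add_mul, mul_add, smul_mul_assoc,
        mul_smul_comm, map_add, map_smul, smul_eq_mul]
      ring
    · simp only [commutatorMap_smul, smul_mul_assoc, mul_smul_comm, map_smul, smul_eq_mul]
      ring
    · have e := fun γ β H : Matrix (Fin N) (Fin N) ℂ => congrArg (pairing γ β)
        (responseCoeff_two_even (commutatorMap (B.mat a)) (commutatorMap H))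
      simp only [map_add] at e
      linear_combination (h a ha 2 + h.neg ha 2 - e γ β H + e γ' β' H') / 2
  -- Polarization gives the symmetric part; the antisymmetric part is the commutator with `⁅X, Y⁆`,
  -- handled by order one.
  have h1 := hsq (X + Y)
  have h2 := h.pairing_one hN hα ⁅X, Y⁆
  rw [← commutatorMap_lie] at h2
  simp only [Ring.lie_def, map_sub] at h2
  simp only [commutatorMap_add, add_mul, mul_add, map_add] at h1
  linear_combination (h1 - hsq X - hsq Y + h2) / 2

theorem ResponseEq.cubicForm_eq (h : ResponseEq B α β γ H β' γ' H') (hα : α ≠ 0)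
    {X : Matrix (Fin N) (Fin N) ℂ} (hX : X.trace = 0) (hX2 : X * X = 0) :
    cubicForm γ β H X X X = cubicForm γ' β' H' X X X := by
  let Z : Matrix (Fin N) (Fin N) ℂ → Matrix (Fin N) (Fin N) ℂ → Matrix (Fin N) (Fin N) ℂ →
      Matrix (Fin N) (Fin N) ℂ → ℂ := fun γ β H x =>
    pairing γ β ⁅⁅⁅commutatorMap x, commutatorMap H⁆, commutatorMap H⁆, commutatorMap H⁆
  have hZ : ∀ γ β H t x y, Z γ β H (x + t • y) = Z γ β H x + t * Z γ β H y := by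
    intro γ β H t x y
    simp only [Z, Ring.lie_def, commutatorMap_add, commutatorMap_smul, add_mul, mul_add, sub_mul,
      mul_sub, smul_mul_assoc, mul_smul_comm, map_add, map_sub, map_smul, smul_eq_mul]
    ring
  -- The linear term of order four is made cubic by the factor `Tr(x²)/α²`, which is `1` on the
  -- sphere and `0` at a square-zero matrix.
  let C : Matrix (Fin N) (Fin N) ℂ → Matrix (Fin N) (Fin N) ℂ → Matrix (Fin N) (Fin N) ℂ → ℂ :=
    fun x y z => (x * y).trace * ((Z γ β H z - Z γ' β' H' z) / α ^ 2)
  have hC : IsTrilinear C := by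
    constructor <;> intros <;>
    · simp only [C, hZ, add_mul, mul_add, smul_mul_assoc, mul_smul_comm, Matrix.trace_add,
        Matrix.trace_smul, smul_eq_mul]
      ring
  have hT := ((isTrilinear_cubicForm γ β H).sub (isTrilinear_cubicForm γ' β' H')).add hC
  have hα' : (α : ℂ) ≠ 0 := by exact_mod_cast hα
  have key := B.eq_zero_of_forall_sphere three_ne_zero hT.isCubic hT.cubic_smul hα
    (fun a ha => ?_) hX
  · simp only [C, hX2, Matrix.trace_zero, zero_mul, add_zero] at key
    exact sub_eq_zero.1 key
  · have hn : (B.mat a * B.mat a).trace = α ^ 2 := by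
      rw [B.trace_mat_mul_mat, ← Complex.ofReal_pow, ← ha]
      simp [dotProduct, sq]
    have e : ∀ γ β H : Matrix (Fin N) (Fin N) ℂ,
        pairing γ β (responseCoeff (commutatorMap (B.mat a) + commutatorMap H)
          (commutatorMap H) 4) -
        pairing γ β (responseCoeff (-commutatorMap (B.mat a) + commutatorMap H)
          (commutatorMap H) 4) =
        2 * (cubicForm γ β H (B.mat a) (B.mat a) (B.mat a) + Z γ β H (B.mat a)) := by
      intro γ β H
      rw [← map_sub, responseCoeff_four_odd, cubicForm, ← commutatorMap_lie, ← map_add]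
      simp only [Algebra.smul_def, map_ofNat, two_mul, map_add]
    have e1 := e γ β H
    have e2 := e γ' β' H'
    have e3 := h a ha 4
    have e4 := h.neg ha 4
    simp only [C, hn]
    rw [mul_div_cancel₀ _ (pow_ne_zero 2 hα')]
    linear_combination (e2 - e1 + e3 - e4) / 2

/-- On a rank one nilpotent the quartic response is the quadratic one times `v ⬝ Hu`, up to a
constant. The test vectors keep the quadratic one nonzero, so `v ⬝ Hu` can be compared. -/
theorem ResponseEq.drift_eq (h : ResponseEq B α β γ H β' γ' H') (hN : N ≠ 0) (hα : α ≠ 0)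
    (hβ0 : β ≠ 0) (hγ0 : γ ≠ 0) (hβ : β.trace = 0) (hγ : γ.trace = 0)
    (hH : H.trace = 0) (hH' : H'.trace = 0) : H' = H := by
  by_contra hne
  obtain ⟨u, v, huv, hne0⟩ := exists_isotropic_pair (sub_ne_zero.2 hne) hβ0 hγ0
    (by rw [Matrix.trace_sub, hH, hH', sub_self]) hβ hγ
  set X := Matrix.vecMulVec u v with hX
  have hmul : ∀ M : Matrix (Fin N) (Fin N) ℂ, X * (M * X) = (v ⬝ᵥ (M *ᵥ u)) • X := by
    intro M
    rw [hX, Matrix.mul_vecMulVec, Matrix.vecMulVec_mul_vecMulVec, Matrix.vecMulVec_smul]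
  have hX2 : X * X = 0 := by
    have := hmul 1
    rwa [one_mul, Matrix.one_mulVec, huv, zero_smul] at this
  have htr : ∀ M : Matrix (Fin N) (Fin N) ℂ, (M * X).trace = v ⬝ᵥ (M *ᵥ u) := by
    intro M
    rw [hX, Matrix.mul_vecMulVec, Matrix.trace_vecMulVec, dotProduct_comm]
  have hXt : X.trace = 0 := by
    have := htr 1
    rwa [one_mul, Matrix.one_mulVec, huv] at this
  have h2 := h.pairing_two hN hα X X
  rw [pairing_of_mul_self_eq_zero hX2 (hmul β), pairing_of_mul_self_eq_zero hX2 (hmul β'), htr,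
    htr] at h2
  have h3 := h.cubicForm_eq hα hXt hX2
  rw [cubicForm_of_mul_self_eq_zero hX2 (hmul H) (hmul β),
    cubicForm_of_mul_self_eq_zero hX2 (hmul H') (hmul β'), htr, htr] at h3
  apply hne0
  rw [Matrix.sub_mulVec, dotProduct_sub]
  linear_combination h3 / 8 - (v ⬝ᵥ (H' *ᵥ u)) * h2 / 2

/-- Equal drifts let order one remove the linear term `⁅⁅a, H⁆, H⁆` from order three, leaving the
cube. Order two makes the difference symmetric, so polarization applies. -/
theorem ResponseEq.pairing_three (h : ResponseEq B α β γ H β' γ' H) (hN : N ≠ 0) (hα : α ≠ 0)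
    (X Y Z : Matrix (Fin N) (Fin N) ℂ) :
    pairing γ β (commutatorMap X * commutatorMap Y * commutatorMap Z) =
      pairing γ' β' (commutatorMap X * commutatorMap Y * commutatorMap Z) := by
  have hT := (isTrilinear_pairing γ β).sub (isTrilinear_pairing γ' β')
  rw [← sub_eq_zero]
  refine hT.eq_zero_of_symm (fun x y z => ?_) (fun x y z => ?_) (fun X => ?_) X Y Z
  · have := h.pairing_two hN hα ⁅x, y⁆ z
    rw [← commutatorMap_lie] at this
    simp only [Ring.lie_def, sub_mul, map_sub] at this
    linear_combination this
  · have := h.pairing_two hN hα x ⁅y, z⁆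
    rw [← commutatorMap_lie] at this
    simp only [Ring.lie_def, mul_sub, map_sub, ← mul_assoc] at this
    linear_combination this
  · obtain ⟨X₀, hX₀, hX⟩ := exists_traceless_commutatorMap_eq hN X
    rw [← hX]
    refine B.eq_zero_of_forall_sphere three_ne_zero hT.isCubic hT.cubic_smul hα (fun a ha => ?_) hX₀
    have e : ∀ γ β : Matrix (Fin N) (Fin N) ℂ,
        pairing γ β (responseCoeff (commutatorMap (B.mat a) + commutatorMap H)
          (commutatorMap H) 3) -
        pairing γ β (responseCoeff (-commutatorMap (B.mat a) + commutatorMap H)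
          (commutatorMap H) 3) =
        2 * (pairing γ β (commutatorMap (B.mat a) * commutatorMap (B.mat a) *
          commutatorMap (B.mat a)) + pairing γ β (commutatorMap ⁅⁅B.mat a, H⁆, H⁆)) := by
      intro γ β
      rw [← map_sub, responseCoeff_three_odd, ← commutatorMap_lie, ← commutatorMap_lie, ← map_add,
        two_mul, map_add, two_mul]
    linear_combination (e γ' β' - e γ β + h a ha 3 - h.neg ha 3) / 2 -
      h.pairing_one hN hα ⁅⁅B.mat a, H⁆, H⁆

end Response

end GeneratorBasis

/-! ### Back to bilinear systems and the Hamiltonian -/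

namespace BDS

variable {n m p : ℕ} {σ : BDS n m p}

theorem exists_b_ne_zero (hn : n ≠ 0) (h : σ.controllabilityMatrix.rank = n) :
    ∃ j, σ.b j ≠ 0 := by
  by_contra! hb
  have hb' : σ.b = 0 := funext hb
  have : σ.controllabilityMatrix = 0 := by
    ext i w
    simp [controllabilityMatrix, hb']
  rw [this, Matrix.rank_zero] at h
  exact hn h.symm

theorem C_ne_zero (hn : n ≠ 0) (h : σ.observabilityMatrix.rank = n) : σ.C ≠ 0 := by
  intro hC
  have : σ.observabilityMatrix = 0 := by
    ext wq i
    simp only [observabilityMatrix, hC, Matrix.of_apply, Matrix.zero_apply]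
    exact congrFun (Matrix.zero_vecMul _) i
  rw [this, Matrix.rank_zero] at h
  exact hn h.symm

theorem similar_of_scalar {σ σ' : BDS n m p} {r : ℝ} (hr : r ≠ 0) (hA : σ'.A = σ.A)
    (hN : σ'.N = σ.N) (hb : σ'.b = r • σ.b) (hC : σ.C = r • σ'.C) : Similar σ σ' := by
  have hinv : (r⁻¹ • (1 : Matrix (Fin n) (Fin n) ℝ))⁻¹ = r • 1 :=
    Matrix.inv_eq_right_inv (by simp [hr])
  refine ⟨r⁻¹ • 1, ?_, ?_, fun j => ?_, ?_, ?_⟩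
  · simp [hr]
  · simp [hinv, hA, hr]
  · simp [hinv, hN, hr]
  · rw [hinv, Matrix.smul_mulVec, Matrix.one_mulVec, hb]
  · rw [hC]
    simp [hr]

end BDS

namespace ClosedQuantumSystem

variable {N p : ℕ} {B : GeneratorBasis N} {S S' : ClosedQuantumSystem N p} {α Δ : ℝ}

theorem responseEq (hα : α ≠ 0) (hΔ : 0 < Δ)
    (h : BDS.Indistinguishable (pulseFamily (N ^ 2 - 1) α) Δ (S.bds B) (S'.bds B)) (q : Fin p) :
    B.ResponseEq α (B.mat (S.bds B).b) (B.mat (S.sampledOutput B Δ q)) S.H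
      (B.mat (S'.bds B).b) (B.mat (S'.sampledOutput B Δ q)) S'.H :=
  fun _ ha k => trace_responseCoeff_eq hα hΔ h ha q k

theorem exists_sampledOutput_ne_zero (h : (S.bds B).C ≠ 0) (Δ : ℝ) :
    ∃ q k, S.sampledOutput B Δ q k ≠ 0 := by
  by_contra! hL
  have hL' : (S.bds B).C * NormedSpace.exp (Δ • (S.bds B).A) = 0 := by
    ext q k
    exact hL q k
  have hu := (Matrix.isUnit_iff_isUnit_det _).1 (Matrix.isUnit_exp (Δ • (S.bds B).A))
  rw [← Matrix.mul_nonsing_inv_cancel_right _ (S.bds B).C hu, hL', Matrix.zero_mul] at h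
  exact h rfl

theorem mat_ne_zero {v : Fin (N ^ 2 - 1) → ℝ} {k : Fin (N ^ 2 - 1)} (h : v k ≠ 0) :
    B.mat v ≠ 0 := by
  intro h0
  have := B.trace_F_mul_mat v k
  rw [h0, mul_zero, Matrix.trace_zero] at this
  exact h (by exact_mod_cast this.symm)

theorem hamiltonian_eq (hCM : (S.bds B).controllabilityMatrix.rank = N ^ 2 - 1)
    (hOM : (S.bds B).observabilityMatrix.rank = N ^ 2 - 1) (hα : α ≠ 0) (hΔ : 0 < Δ)
    (h : BDS.Indistinguishable (pulseFamily (N ^ 2 - 1) α) Δ (S.bds B) (S'.bds B)) :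
    S'.H = S.H := by
  -- For `N ≤ 1` there are no coordinates, and full rank gives no nonzero vector.
  by_cases hn : N ^ 2 - 1 = 0
  · have : IsEmpty (Fin (N ^ 2 - 1)) := by rw [hn]; infer_instance
    rw [← S'.mat_θ B, ← S.mat_θ B, Subsingleton.elim (S'.θ B) (S.θ B)]
  have hN : N ≠ 0 := by rintro rfl; exact hn rfl
  obtain ⟨j, hj⟩ := BDS.exists_b_ne_zero hn hCM
  obtain ⟨q, k, hk⟩ := exists_sampledOutput_ne_zero (BDS.C_ne_zero hn hOM) Δ
  exact (responseEq hα hΔ h q).drift_eq hN hα (mat_ne_zero hj) (mat_ne_zero hk) (B.trace_mat _)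
    (B.trace_mat _) S.H_trace S'.H_trace

theorem bds_A_eq (hH : S'.H = S.H) : (S'.bds B).A = (S.bds B).A := by
  rw [bds_A, bds_A, B.mat_injective ((S'.mat_θ B).trans (hH.trans (S.mat_θ B).symm))]

theorem similar_bds (hCM : (S.bds B).controllabilityMatrix.rank = N ^ 2 - 1)
    (hOM : (S.bds B).observabilityMatrix.rank = N ^ 2 - 1) (hα : α ≠ 0) (hΔ : 0 < Δ)
    (h : BDS.Indistinguishable (pulseFamily (N ^ 2 - 1) α) Δ (S.bds B) (S'.bds B)) :
    BDS.Similar (S.bds B) (S'.bds B) := by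
  have hH := hamiltonian_eq hCM hOM hα hΔ h
  have hA : (S'.bds B).A = (S.bds B).A := bds_A_eq hH
  by_cases hn : N ^ 2 - 1 = 0
  · have : IsEmpty (Fin (N ^ 2 - 1)) := by rw [hn]; infer_instance
    exact BDS.similar_of_scalar one_ne_zero hA rfl (Subsingleton.elim _ _)
      (Subsingleton.elim _ _)
  have hN : N ≠ 0 := by rintro rfl; exact hn rfl
  obtain ⟨j, hj⟩ := BDS.exists_b_ne_zero hn hCM
  obtain ⟨q, k, hk⟩ := exists_sampledOutput_ne_zero (BDS.C_ne_zero hn hOM) Δ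
  -- The coordinates of `β ⊗ γ`; a nonzero entry fixes the scalar relating the two systems.
  have hprod : ∀ q k j, S.sampledOutput B Δ q k * (S.bds B).b j =
      S'.sampledOutput B Δ q k * (S'.bds B).b j := by
    intro q k j
    have hr := responseEq hα hΔ h q
    have h2 := hr.pairing_two hN hα
    rw [hH] at hr
    have ht := congrArg (fun X => (B.F j * X).trace) (tensor_eq (B.trace_mat _) (B.trace_mat _)
      (B.trace_mat _) (B.trace_mat _) h2 (hr.pairing_three hN hα) (B.F k))
    simp only [Matrix.mul_smul, Matrix.trace_smul, B.trace_F_mul_mat, smul_eq_mul] at ht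
    exact_mod_cast ht
  have hne : S'.sampledOutput B Δ q k * (S'.bds B).b j ≠ 0 := hprod q k j ▸ mul_ne_zero hk hj
  have hk' := left_ne_zero_of_mul hne
  have hj' := right_ne_zero_of_mul hne
  have hb : ∀ i, (S'.bds B).b i =
      S.sampledOutput B Δ q k / S'.sampledOutput B Δ q k * (S.bds B).b i := by
    intro i
    rw [div_mul_eq_mul_div, hprod, mul_div_cancel_left₀ _ hk']
  refine BDS.similar_of_scalar (div_ne_zero hk hk') hA rfl (funext hb) ?_
  -- The drifts agree, so the free evolution up to `Δ` is common to both systems and can be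
  -- cancelled.
  have hL : (S.bds B).C * NormedSpace.exp (Δ • (S.bds B).A) =
      ((S.sampledOutput B Δ q k / S'.sampledOutput B Δ q k) • (S'.bds B).C) *
        NormedSpace.exp (Δ • (S.bds B).A) := by
    rw [Matrix.smul_mul]
    nth_rewrite 2 [← hA]
    ext q' i
    refine mul_right_cancel₀ hj ?_
    refine (hprod q' i j).trans ?_
    rw [hb j]
    change _ = _ * S'.sampledOutput B Δ q' i * _
    ring
  have hu := (Matrix.isUnit_iff_isUnit_det _).1 (Matrix.isUnit_exp (Δ • (S.bds B).A))
  have := congrArg (· * (NormedSpace.exp (Δ • (S.bds B).A))⁻¹) hL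
  simpa only [Matrix.mul_nonsing_inv_cancel_right _ _ hu] using this

theorem M_mulVec_eq_iff (hM : MatrixInvertible B.M)
    (w : Fin (N ^ 2 - 1) ⊕ (Fin (N ^ 2 - 1) × Fin (N ^ 2 - 1)) → ℂ) :
    B.M *ᵥ w = Sum.elim (fun jk => ((S.bds B).A jk.1 jk.2 : ℂ)) (fun _ => 0) ↔
      w = Sum.elim (fun j => (S.θ B j : ℂ)) (fun _ => 0) := by
  have hθ : B.M *ᵥ Sum.elim (fun j => (S.θ B j : ℂ)) (fun _ => 0) =
      Sum.elim (fun jk => ((S.bds B).A jk.1 jk.2 : ℂ)) (fun _ => 0) := by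
    have h0 : (fun _ : Fin (N ^ 2 - 1) × Fin (N ^ 2 - 1) => (0 : ℂ)) = 0 := rfl
    rw [GeneratorBasis.M, Matrix.fromBlocks_mulVec]
    simp only [Sum.elim_comp_inl, Sum.elim_comp_inr, h0, Matrix.mulVec_zero, add_zero,
      Matrix.zero_mulVec]
    refine congrArg₂ Sum.elim (funext fun jk => ?_) rfl
    simp [GeneratorBasis.T₁, Matrix.mulVec, dotProduct, bds, mul_comm]
  obtain ⟨Y, -, hY⟩ := hM
  constructor
  · intro h
    rw [← Matrix.one_mulVec w, ← hY, ← Matrix.mulVec_mulVec, h, ← hθ, Matrix.mulVec_mulVec, hY,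
      Matrix.one_mulVec]
  · rintro rfl
    exact hθ

end ClosedQuantumSystem

end

theorem mainTheorem8 {N p : ℕ} (B : GeneratorBasis N) (S : ClosedQuantumSystem N p)
    (hCM : (S.bds B).controllabilityMatrix.rank = N ^ 2 - 1)
    (hOM : (S.bds B).observabilityMatrix.rank = N ^ 2 - 1)
    (α : ℝ) (hα : α ≠ 0) (Δ : ℝ) (hΔ : 0 < Δ) :
    (∀ S' : ClosedQuantumSystem N p,
      BDS.Indistinguishable (pulseFamily (N ^ 2 - 1) α) Δ (S.bds B) (S'.bds B) →
        BDS.Similar (S.bds B) (S'.bds B)) ∧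
    (MatrixInvertible B.M →
      ∀ S' : ClosedQuantumSystem N p,
        BDS.Indistinguishable (pulseFamily (N ^ 2 - 1) α) Δ (S.bds B) (S'.bds B) →
          S'.H = S.H ∧
          ∃ θ : Fin (N ^ 2 - 1) → ℝ,
            (∀ w, B.M *ᵥ w = Sum.elim (fun jk => ((S'.bds B).A jk.1 jk.2 : ℂ)) (fun _ => 0) ↔
              w = Sum.elim (fun j => (θ j : ℂ)) (fun _ => 0)) ∧
            S.H = ∑ j, (θ j : ℂ) • B.F j) := by
  refine ⟨fun S' h => ClosedQuantumSystem.similar_bds hCM hOM hα hΔ h, fun hM S' h => ?_⟩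
  have hH := ClosedQuantumSystem.hamiltonian_eq hCM hOM hα hΔ h
  exact ⟨hH, S'.θ B, ClosedQuantumSystem.M_mulVec_eq_iff hM, hH ▸ (S'.mat_θ B).symm⟩
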